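/- Let $V,W$ be real Banach spaces, $T\ge 0$ and $\beta\in(\frac13,\frac12]$. For a path $X$ on $[0,T]$ write $X_{s,t}:=X_t-X_s$. For $\gamma\in(0,1]$ a path is $\gamma$-H\"older if $\sup_{s\ne t}|X_{s,t}|/|t-s|^{\gamma}<\infty$. Let $V\otimes V$ denote the completed projective tensor product, so that every $B\in L(V,L(V,W))$ induces a continuous linear map $V\otimes V\to W$ with $v\otimes w\mapsto B(v)w$. Let $\mathbf X=(X,\mathbb X)$ be a $\beta$-H\"older rough path over $V$, that is, $X:[0,T]\to V$ is $\beta$-H\"older, $\mathbb X:[0,T]^2\to V\otimes V$ satisfies $\sup_{s\neq t}|\mathbb X_{s,t}|/|t-s|^{2\beta}<\infty$, and $\mathbb X_{s,t}-\mathbb X_{s,u}-\mathbb X_{u,t}=X_{s,u}\otimes X_{u,t}$ for all $s,u,t\in[0,T]$. Let $f_0\in{\rm Lip}([0,T]\times W,W)$, that is, $f_0:[0,T]\times W\to W$ is continuous and there is $L>0$ with $|f_0(t,y)-f_0(t,z)|\le L|y-z|$ for all $t\in[0,T]$ and $y,z\in W$. Let $f\in C_b^{2\beta,3}([0,T]\times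 W,L(V,W))$, that is, $f(t,\cdot)$ is three times continuously Fr\'echet differentiable for each $t\in[0,T]$ and $$\sup_{t\in[0,T]}\sum_{k=0}^{3}\sup_{y\in W}|D_y^kf(t,y)|+\sum_{k=0}^{2}\,\sup_{y\in W}\,\sup_{s\neq t}\frac{|D_y^kf(t,y)-D_y^kf(s,y)|}{|t-s|^{2\beta}}<\infty .$$ Let $\mathscr D_X^{2\beta}([0,T],W)$ be the space of controlled rough paths, that is, of pairs $(Y,Y')$ of $\beta$-H\"older paths $Y:[0,T]\to W$ and $Y':[0,T]\to L(V,W)$ such that $\sup_{s\ne t}|Y_{s,t}-Y'_sX_{s,t}|/|t-s|^{2\beta}<\infty$. A pair $(Y,Y')\in\mathscr D_X^{2\beta}([0,T],W)$ is called a (global) solution of the rough ordinary differential equation $$dY_t=f_0(t,Y_t)\,dt+f(t,Y_t)\,d\mathbf X_t,\qquad Y_0=\xi,$$ if $Y'_t=f(t,Y_t)$ and $$Y_t=\xi+\int_0^tf_0(s,Y_s)\,ds+\int_0^tf(s,Y_s)\,d\mathbf X_s\qquad\text{for all }t\in[0,T],$$ where the rough integral is the limit $$\int_0^tf(s,Y_s)\,d\mathbf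 X_s=\lim_{|\Pi|\to0}\sum_{[u,v]\in\Pi}\Big(f(u,Y_u)X_{u,v}+\big(D_yf(u,Y_u)Y'_u\big)\mathbb X_{u,v}\Big)$$ over partitions $\Pi$ of $[0,t]$ with mesh $|\Pi|$ tending to $0$. Then for every $\xi\in W$ there exists a unique solution $(Y,Y')\in\mathscr D_X^{2\beta}([0,T],W)$ of this equation with $Y_0=\xi$. -/

import Mathlib

open Set MeasureTheory

/-- The tensor product `V ⊗ V` of a real Banach space `V` with itself: the completion of the
algebraic tensor product for the projective norm (the norm that Mathlib puts on
`PiTensorProduct`). It is the tensor product for which bounded bilinear maps on `V × V` are the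
same as bounded linear maps on `V ⊗ V`. -/
abbrev ProjTensor (V : Type*) [NormedAddCommGroup V] [NormedSpace ℝ V] : Type _ :=
  UniformSpace.Completion (PiTensorProduct ℝ (fun _ : Fin 2 => V))

/-- The elementary tensor `v ⊗ w`. -/
noncomputable def elemTensor {V : Type*} [NormedAddCommGroup V] [NormedSpace ℝ V]
    (v w : V) : ProjTensor V :=
  ((PiTensorProduct.tprod ℝ ![v, w] : PiTensorProduct ℝ (fun _ : Fin 2 => V)) : ProjTensor V)

/-- The embedding `L(V, L(V, W)) ↪ L(V ⊗ V, W)`: the continuous linear map on `V ⊗ V`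
with `v ⊗ w ↦ B v w`. -/
noncomputable def tensorLift {V W : Type*} [NormedAddCommGroup V] [NormedSpace ℝ V]
    [NormedAddCommGroup W] [NormedSpace ℝ W] [CompleteSpace W]
    (B : V →L[ℝ] V →L[ℝ] W) : ProjTensor V →L[ℝ] W :=
  (PiTensorProduct.liftEquiv ℝ (fun _ : Fin 2 => V) W
    (B.uncurryBilinear.compContinuousLinearMap
      (fun _ => (ContinuousLinearMap.id ℝ V).prod (ContinuousLinearMap.id ℝ V)))).extend
    (UniformSpace.Completion.toComplL :
      PiTensorProduct ℝ (fun _ : Fin 2 => V) →L[ℝ] ProjTensor V)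

theorem tensorLift_elemTensor {V W : Type*} [NormedAddCommGroup V] [NormedSpace ℝ V]
    [NormedAddCommGroup W] [NormedSpace ℝ W] [CompleteSpace W]
    (B : V →L[ℝ] V →L[ℝ] W) (v w : V) : tensorLift B (elemTensor v w) = B v w := by
  unfold tensorLift elemTensor
  have h := ContinuousLinearMap.extend_eq
    (PiTensorProduct.liftEquiv ℝ (fun _ : Fin 2 => V) W
      (B.uncurryBilinear.compContinuousLinearMap
        (fun _ => (ContinuousLinearMap.id ℝ V).prod (ContinuousLinearMap.id ℝ V))))
    (e := (UniformSpace.Completion.toComplL :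
      PiTensorProduct ℝ (fun _ : Fin 2 => V) →L[ℝ] ProjTensor V))
    (by simpa using UniformSpace.Completion.denseRange_coe)
    (by simpa using UniformSpace.Completion.isUniformInducing_coe _)
    (PiTensorProduct.tprod ℝ ![v, w])
  rw [UniformSpace.Completion.coe_toComplL] at h
  rw [h]
  simp [PiTensorProduct.liftEquiv]

/-- `‖Ξ‖_γ < ∞` for a two-parameter path `Ξ` on `[0,T]²`. -/
def FiniteHolder {E : Type*} [NormedAddCommGroup E] (γ T : ℝ) (Ξ : ℝ → ℝ → E) : Prop :=
  ∃ C : ℝ, ∀ s ∈ Icc 0 T, ∀ t ∈ Icc 0 T, s ≠ t → ‖Ξ s t‖ ≤ C * |t - s| ^ γ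

/-- `Y ∈ 𝒞^γ([0,T], E)`: the path `Y` is `γ`-Hölder continuous on `[0,T]`. -/
def IsHolderPath {E : Type*} [NormedAddCommGroup E] (γ T : ℝ) (Y : ℝ → E) : Prop :=
  FiniteHolder γ T (fun s t => Y t - Y s)

/-- `(X, 𝕏)` is an `α`-Hölder rough path over `V` on `[0,T]`. -/
structure IsRoughPath {V : Type*} [NormedAddCommGroup V] [NormedSpace ℝ V]
    (α T : ℝ) (X : ℝ → V) (XX : ℝ → ℝ → ProjTensor V) : Prop where
  holder_path : IsHolderPath α T X
  holder_area : FiniteHolder (2 * α) T XX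
  chen : ∀ s ∈ Icc 0 T, ∀ u ∈ Icc 0 T, ∀ t ∈ Icc 0 T,
    XX s t - XX s u - XX u t = elemTensor (X u - X s) (X t - X u)

/-- `(Y, Y') ∈ 𝒟_X^{2α}([0,T], W)`: `Y` is controlled by `X` with Gubinelli derivative `Y'`. -/
structure IsControlled {V W : Type*} [NormedAddCommGroup V] [NormedSpace ℝ V]
    [NormedAddCommGroup W] [NormedSpace ℝ W]
    (α T : ℝ) (X : ℝ → V) (Y : ℝ → W) (Y' : ℝ → V →L[ℝ] W) : Prop where
  holder_path : IsHolderPath α T Y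
  holder_deriv : IsHolderPath α T Y'
  holder_remainder : FiniteHolder (2 * α) T (fun s t => Y t - Y s - Y' s (X t - X s))

/-- `I = ∫_a^b Z_s d𝐗_s`, the limit of the compensated Riemann sums
`∑_{[s,t] ∈ Π} (Z_s X_{s,t} + Z'_s 𝕏_{s,t})` over partitions `Π` of `[a,b]` as the mesh of `Π`
tends to zero. A partition is given by its points `a = τ 0 < τ 1 < ⋯ < τ n = b`. -/
def HasRoughIntegral {V W : Type*} [NormedAddCommGroup V] [NormedSpace ℝ V]
    [NormedAddCommGroup W] [NormedSpace ℝ W] [CompleteSpace W]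
    (X : ℝ → V) (XX : ℝ → ℝ → ProjTensor V)
    (Z : ℝ → V →L[ℝ] W) (Z' : ℝ → V →L[ℝ] V →L[ℝ] W) (a b : ℝ) (I : W) : Prop :=
  ∀ ε > (0 : ℝ), ∃ δ > (0 : ℝ), ∀ (n : ℕ) (τ : ℕ → ℝ), τ 0 = a → τ n = b →
    (∀ i < n, τ i < τ (i + 1) ∧ τ (i + 1) - τ i < δ) →
    ‖(∑ i ∈ Finset.range n, (Z (τ i) (X (τ (i + 1)) - X (τ i))
        + tensorLift (Z' (τ i)) (XX (τ i) (τ (i + 1))))) - I‖ < ε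

/-- `f₀ ∈ Lip([0,T] × W, E)`: jointly continuous on `[0,T] × W`, and Lipschitz in the space
variable uniformly in time. -/
structure IsLip {W E : Type*} [NormedAddCommGroup W] [NormedAddCommGroup E]
    (T : ℝ) (f₀ : ℝ → W → E) : Prop where
  continuousOn : ContinuousOn (fun p : ℝ × W => f₀ p.1 p.2) (Icc 0 T ×ˢ univ)
  lipschitz : ∃ L : ℝ, ∀ t ∈ Icc 0 T, ∀ y z : W, ‖f₀ t y - f₀ t z‖ ≤ L * ‖y - z‖

/-- `f ∈ C_b^{γ,n}([0,T] × W, E)`: `f t` is `n` times continuously Fréchet differentiable with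
derivatives of order `0, …, n` bounded uniformly in `t ∈ [0,T]`, and the space derivatives of
order `0, …, n - 1` are `γ`-Hölder in time, uniformly in the space variable. -/
structure IsCb {W E : Type*} [NormedAddCommGroup W] [NormedSpace ℝ W]
    [NormedAddCommGroup E] [NormedSpace ℝ E]
    (γ : ℝ) (n : ℕ) (T : ℝ) (f : ℝ → W → E) : Prop where
  contDiff : ∀ t ∈ Icc 0 T, ContDiff ℝ n (f t)
  bounded : ∃ C : ℝ, ∀ t ∈ Icc 0 T, ∀ k ≤ n, ∀ y : W, ‖iteratedFDeriv ℝ k (f t) y‖ ≤ C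
  holder : ∃ C : ℝ, ∀ k < n, ∀ y : W, ∀ s ∈ Icc 0 T, ∀ t ∈ Icc 0 T,
    ‖iteratedFDeriv ℝ k (f t) y - iteratedFDeriv ℝ k (f s) y‖ ≤ C * |t - s| ^ γ

/-- `(Y, Y') ∈ 𝒟_X^{2α}([0,T], W)` is a (global) solution of
`dY_t = f₀(t, Y_t) dt + f(t, Y_t) d𝐗_t`, `Y_0 = ξ`: one has `Y' = f(Y)`, and
`Y_t = ξ + ∫_0^t f₀(s, Y_s) ds + ∫_0^t f(s, Y_s) d𝐗_s` for all `t ∈ [0,T]`. The rough integral is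
that of the controlled path `(f(Y), f(Y)')` with `f(Y)'_t = D_y f(t, Y_t) Y'_t`. -/
structure IsRODESolution {V W : Type*} [NormedAddCommGroup V] [NormedSpace ℝ V]
    [NormedAddCommGroup W] [NormedSpace ℝ W] [CompleteSpace W]
    (α T : ℝ) (X : ℝ → V) (XX : ℝ → ℝ → ProjTensor V)
    (f₀ : ℝ → W → W) (f : ℝ → W → V →L[ℝ] W) (ξ : W)
    (Y : ℝ → W) (Y' : ℝ → V →L[ℝ] W) : Prop where
  controlled : IsControlled α T X Y Y'
  deriv_eq : ∀ t ∈ Icc 0 T, Y' t = f t (Y t)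
  integral_eq : ∀ t ∈ Icc 0 T, ∃ I : W,
    HasRoughIntegral X XX (fun s => f s (Y s))
      (fun s => (fderiv ℝ (f s) (Y s)).comp (Y' s)) 0 t I ∧
    Y t = ξ + (∫ s in (0 : ℝ)..t, f₀ s (Y s)) + I

/-!
Existence and uniqueness for `dY = f₀(t, Y) dt + f(t, Y) d𝐗` by Picard iteration in the space of
controlled paths, carried out on all of `[0, T]` at once.

*Rough integrals.* The germ `Ξ_{s,t} = Z_s X_{s,t} + Z'_s 𝕏_{s,t}` of a controlled path has, by
Chen's relation, a defect `Ξ_{s,t} - Ξ_{s,u} - Ξ_{u,t}` of order `3β > 1`. The sewing lemma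
(`exists_sewing`) produces a path whose increments agree with `Ξ` up to order `3β`, and such a path
is the limit of the compensated Riemann sums (`hasRoughIntegral_of_expansion`). Conversely, a
two-parameter map of order `3β` is bounded by its defect alone (`norm_le_of_defect`). The Picard map
is therefore encoded by the one-step expansion of its image (`IsPicardStep`), its error is bounded
by the controlled norm of the integrand, and solutions are the same as fixed points
(`IsPicardStep.isRODESolution`, `IsRODESolution.isPicardStep`).

*A priori bound.* The drift is unbounded, so the iterates may grow, but every estimate is linear in
the controlled norm: in the Taylor expansion of `f(t, Y_t)` only the part `Y'_s X_{s,t}` of the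
increment, which is bounded independently of `Y`, enters quadratically
(`FieldBound.norm_comp_remainder_le`). A norm that measures increments on windows of a small length
`h`, with the exponential weight `exp (t / h)`, turns this into an invariant ball for the Picard map
(`IsPicardStep.weightedBound`), with `h` independent of the initial value. The iterates are thus
bounded in the controlled norm of `[0, T]`.

*Contraction.* On bounded sets of controlled paths, the composition with `f` is Lipschitz in the
controlled norm, which uses three derivatives of `f` (`norm_taylor_sub_taylor_le`, `PairBound`). For
small `h`, a Picard step halves the weighted distance of two such paths
(`IsPicardStep.weightedBound_sub`). Hence the iterates converge to a fixed point
(`exists_isPicardStep_self`), and two fixed points agree (`IsPicardStep.eqOn`).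
-/

/-! ### The lift of bilinear maps to the tensor product -/

theorem tensorLift_coe {V W : Type*} [NormedAddCommGroup V] [NormedSpace ℝ V]
    [NormedAddCommGroup W] [NormedSpace ℝ W] [CompleteSpace W]
    (B : V →L[ℝ] V →L[ℝ] W) (x : PiTensorProduct ℝ (fun _ : Fin 2 => V)) :
    tensorLift B (x : ProjTensor V) =
      PiTensorProduct.liftEquiv ℝ (fun _ : Fin 2 => V) W
        (B.uncurryBilinear.compContinuousLinearMap
          (fun _ => (ContinuousLinearMap.id ℝ V).prod (ContinuousLinearMap.id ℝ V))) x := by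
  unfold tensorLift
  have h := ContinuousLinearMap.extend_eq
    (PiTensorProduct.liftEquiv ℝ (fun _ : Fin 2 => V) W
      (B.uncurryBilinear.compContinuousLinearMap
        (fun _ => (ContinuousLinearMap.id ℝ V).prod (ContinuousLinearMap.id ℝ V))))
    (e := (UniformSpace.Completion.toComplL :
      PiTensorProduct ℝ (fun _ : Fin 2 => V) →L[ℝ] ProjTensor V))
    (by simpa using UniformSpace.Completion.denseRange_coe)
    (by simpa using UniformSpace.Completion.isUniformInducing_coe _) x
  rwa [UniformSpace.Completion.coe_toComplL] at h

theorem tensorLift_sub {V W : Type*} [NormedAddCommGroup V] [NormedSpace ℝ V]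
    [NormedAddCommGroup W] [NormedSpace ℝ W] [CompleteSpace W]
    (B B' : V →L[ℝ] V →L[ℝ] W) (x : ProjTensor V) :
    tensorLift (B - B') x = tensorLift B x - tensorLift B' x := by
  induction x using UniformSpace.Completion.induction_on with
  | hp => exact isClosed_eq (by fun_prop) (by fun_prop)
  | ih x =>
    rw [tensorLift_coe, tensorLift_coe, tensorLift_coe, ← sub_apply, ← map_sub]
    congr 2

theorem norm_tensorLift_apply_le {V W : Type*} [NormedAddCommGroup V] [NormedSpace ℝ V]
    [NormedAddCommGroup W] [NormedSpace ℝ W] [CompleteSpace W]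
    (B : V →L[ℝ] V →L[ℝ] W) (x : ProjTensor V) :
    ‖tensorLift B x‖ ≤ ‖B‖ * ‖x‖ := by
  induction x using UniformSpace.Completion.induction_on with
  | hp => exact isClosed_le (by fun_prop) (by fun_prop)
  | ih x =>
    rw [tensorLift_coe, UniformSpace.Completion.norm_coe]
    refine (ContinuousLinearMap.le_opNorm _ _).trans ?_
    gcongr
    refine ((PiTensorProduct.liftIsometry ℝ (fun _ : Fin 2 => V) W).norm_map _).le.trans ?_
    refine ContinuousMultilinearMap.opNorm_le_bound (norm_nonneg B) fun m => ?_
    simpa [Fin.prod_univ_two, mul_assoc] using B.le_opNorm₂ (m 0) (m 1)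

theorem elemTensor_zero_left {V : Type*} [NormedAddCommGroup V] [NormedSpace ℝ V] (w : V) :
    elemTensor 0 w = 0 := by
  unfold elemTensor
  rw [(PiTensorProduct.tprod ℝ).map_coord_zero (m := ![(0 : V), w]) 0 rfl]
  exact UniformSpace.Completion.coe_zero

/-! ### Mean value inequalities -/

section Calculus

variable {E F : Type*} [NormedAddCommGroup E] [NormedSpace ℝ E]
  [NormedAddCommGroup F] [NormedSpace ℝ F]

theorem norm_sub_le_of_hasFDerivAt {g : E → F} {g' : E → E →L[ℝ] F} {L : ℝ}
    (hg : ∀ y, HasFDerivAt g (g' y) y) (hL : ∀ y, ‖g' y‖ ≤ L) (y z : E) :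
    ‖g y - g z‖ ≤ L * ‖y - z‖ :=
  convex_univ.norm_image_sub_le_of_norm_hasFDerivWithin_le
    (fun x _ => (hg x).hasFDerivWithinAt) (fun x _ => hL x) (mem_univ z) (mem_univ y)

/-- The four-point inequality for a map with bounded and Lipschitz derivative: it bounds the
increment of `g y - g z` by the increment of `y - z`. -/
theorem norm_sub_sub_sub_le_of_hasFDerivAt {g : E → F} {g' : E → E →L[ℝ] F} {L : ℝ}
    (hg : ∀ y, HasFDerivAt g (g' y) y) (hL : ∀ y, ‖g' y‖ ≤ L)
    (hL' : ∀ y z, ‖g' y - g' z‖ ≤ L * ‖y - z‖) (y₀ y₁ z₀ z₁ : E) :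
    ‖(g y₁ - g z₁) - (g y₀ - g z₀)‖ ≤
      L * ‖(y₁ - z₁) - (y₀ - z₀)‖ + L * ‖y₁ - y₀‖ * ‖y₀ - z₀‖ := by
  have h1 : ‖(g (y₀ + (y₁ - y₀)) - g y₀) - (g (z₀ + (y₁ - y₀)) - g z₀)‖ ≤
      L * ‖y₁ - y₀‖ * ‖y₀ - z₀‖ := by
    refine norm_sub_le_of_hasFDerivAt (g := fun y => g (y + (y₁ - y₀)) - g y)
      (g' := fun y => g' (y + (y₁ - y₀)) - g' y) (fun y => ?_) (fun y => ?_) y₀ z₀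
    · exact ((hasFDerivAt_comp_add_right _).2 (hg _)).sub (hg y)
    · simpa using hL' (y + (y₁ - y₀)) y
  have h2 := norm_sub_le_of_hasFDerivAt hg hL (z₀ + (y₁ - y₀)) z₁
  have e1 : z₀ + (y₁ - y₀) - z₁ = (y₁ - z₁) - (y₀ - z₀) := by abel
  rw [e1] at h2
  calc _ = ‖((g (y₀ + (y₁ - y₀)) - g y₀) - (g (z₀ + (y₁ - y₀)) - g z₀))
        + (g (z₀ + (y₁ - y₀)) - g z₁)‖ := by
        rw [add_sub_cancel]; congr 1; abel
    _ ≤ _ := (norm_add_le _ _).trans (by linarith)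

theorem norm_taylor_le_of_hasFDerivAt {g : E → F} {g' : E → E →L[ℝ] F} {L : ℝ}
    (hL0 : 0 ≤ L) (hg : ∀ y, HasFDerivAt g (g' y) y)
    (hL' : ∀ y z, ‖g' y - g' z‖ ≤ L * ‖y - z‖) (y p : E) :
    ‖g (y + p) - g y - g' y p‖ ≤ L * ‖p‖ * ‖p‖ := by
  have h := (convex_closedBall y ‖p‖).norm_image_sub_le_of_norm_hasFDerivWithin_le' (𝕜 := ℝ)
    (f := g) (f' := g') (φ := g' y) (C := L * ‖p‖) (x := y) (y := y + p)
    (fun x _ => (hg x).hasFDerivWithinAt)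
    (fun x hx => (hL' x y).trans (by gcongr; simpa [dist_eq_norm] using hx))
    (by simp) (by simp)
  simpa using h

/-- Stability of the first-order Taylor remainder `T y p = g (y + p) - g y - g' y p` in both
arguments: `∂T/∂y` is of second order in `p`, and `∂T/∂p` is of first order in `p`. -/
theorem norm_taylor_sub_taylor_le {g : E → F} {g' : E → E →L[ℝ] F}
    {g'' : E → E →L[ℝ] E →L[ℝ] F} {L : ℝ} (hL0 : 0 ≤ L)
    (hg : ∀ y, HasFDerivAt g (g' y) y) (hg' : ∀ y, HasFDerivAt g' (g'' y) y)
    (hL : ∀ y, ‖g'' y‖ ≤ L) (hL' : ∀ y z, ‖g'' y - g'' z‖ ≤ L * ‖y - z‖) (y z p q : E) :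
    ‖(g (y + p) - g y - g' y p) - (g (z + q) - g z - g' z q)‖ ≤
      L * ‖p‖ * ‖p‖ * ‖y - z‖ + L * (‖p‖ + ‖q‖) * ‖p - q‖ := by
  have h1 : ‖(g (y + p) - g y - g' y p) - (g (z + p) - g z - g' z p)‖ ≤
      L * ‖p‖ * ‖p‖ * ‖y - z‖ := by
    refine norm_sub_le_of_hasFDerivAt (g := fun y => g (y + p) - g y - g' y p)
      (g' := fun y => g' (y + p) - g' y - (g'' y).flip p) (fun y => ?_) (fun y => ?_) y z
    · refine (((hasFDerivAt_comp_add_right _).2 (hg _)).sub (hg y)).sub ?_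
      exact ((hg' y).clm_apply (hasFDerivAt_const p y)).congr_fderiv (by ext; simp)
    · have hsym : (g'' y).flip p = g'' y p := by
        ext v
        exact (second_derivative_symmetric hg (hg' y) v p)
      rw [hsym]
      exact norm_taylor_le_of_hasFDerivAt hL0 hg' hL' y p
  have h2 : ‖(g (z + p) - g' z p) - (g (z + q) - g' z q)‖ ≤ L * (‖p‖ + ‖q‖) * ‖p - q‖ := by
    have h := (convex_closedBall (0 : E) (‖p‖ + ‖q‖)).norm_image_sub_le_of_norm_hasFDerivWithin_le
      (𝕜 := ℝ) (f := fun p => g (z + p) - g' z p) (f' := fun p => g' (z + p) - g' z)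
      (C := L * (‖p‖ + ‖q‖)) (x := q) (y := p)
      (fun x _ => (((hasFDerivAt_comp_add_left _).2 (hg _)).sub (g' z).hasFDerivAt).hasFDerivWithinAt)
      (fun x hx => (norm_sub_le_of_hasFDerivAt hg' hL (z + x) z).trans
        (by gcongr; simpa [dist_eq_norm] using hx))
      (by simp) (by simp)
    simpa using h
  calc _ = ‖((g (y + p) - g y - g' y p) - (g (z + p) - g z - g' z p)) +
        ((g (z + p) - g' z p) - (g (z + q) - g' z q))‖ := by congr 1; abel
    _ ≤ _ := (norm_add_le _ _).trans (by linarith)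

end Calculus

/-! ### The sewing lemma -/

section Sewing

variable {E : Type*} [NormedAddCommGroup E] {θ C : ℝ} {Ξ : ℝ → ℝ → E}

/-- The constant `1 / (1 - 2^(1 - θ)) = ∑ k, 2^(k * (1 - θ))` of the sewing lemma. -/
noncomputable def sewingConst (θ : ℝ) : ℝ := (1 - (2 : ℝ) ^ (1 - θ))⁻¹

theorem two_rpow_one_sub_lt_one (hθ : 1 < θ) : (2 : ℝ) ^ (1 - θ) < 1 :=
  Real.rpow_lt_one_of_one_lt_of_neg one_lt_two (by linarith)

theorem sewingConst_pos (hθ : 1 < θ) : 0 < sewingConst θ :=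
  inv_pos.2 (by linarith [two_rpow_one_sub_lt_one hθ])

theorem sewingConst_mul (hθ : 1 < θ) : sewingConst θ * (2 : ℝ) ^ (1 - θ) + 1 = sewingConst θ := by
  have h : (1 - (2 : ℝ) ^ (1 - θ)) ≠ 0 := by linarith [two_rpow_one_sub_lt_one hθ]
  unfold sewingConst
  field_simp
  ring

theorem two_mul_half_rpow {d : ℝ} (hd : 0 ≤ d) (θ : ℝ) :
    2 * (d / 2) ^ θ = (2 : ℝ) ^ (1 - θ) * d ^ θ := by
  rw [Real.div_rpow hd zero_le_two, Real.rpow_sub two_pos, Real.rpow_one]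
  ring

theorem Monotone.exists_mem_step {τ : ℕ → ℝ} (hτ : Monotone τ) {c : ℝ} :
    ∀ {n : ℕ}, 0 < n → τ 0 ≤ c → c ≤ τ n → ∃ m < n, τ m ≤ c ∧ c ≤ τ (m + 1)
  | n + 1, _, h0, hn => by
    by_cases h : c ≤ τ n ∧ 0 < n
    · obtain ⟨m, hm, h⟩ := hτ.exists_mem_step h.2 h0 h.1
      exact ⟨m, by omega, h⟩
    · refine ⟨n, by omega, ?_, hn⟩
      rcases Nat.eq_zero_or_pos n with rfl | hpos
      · exact h0
      · exact (not_le.1 fun h' => h ⟨h', hpos⟩).le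

/-- Riemann sums of a germ with defect of order `θ > 1` stay close to the germ, uniformly in the
partition. By induction on the number of points: the partition is cut at the interval that
contains the midpoint, so that both remaining parts have at most half the length. -/
theorem norm_sum_sub_le_of_defect (hθ : 1 < θ) (hC : 0 ≤ C) (n : ℕ) :
    ∀ τ : ℕ → ℝ, Monotone τ →
    (∀ s u t, τ 0 ≤ s → s ≤ u → u ≤ t → t ≤ τ n →
      ‖Ξ s t - Ξ s u - Ξ u t‖ ≤ C * (t - s) ^ θ) →
    ‖(∑ i ∈ Finset.range n, Ξ (τ i) (τ (i + 1))) - Ξ (τ 0) (τ n)‖ ≤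
      2 * sewingConst θ * C * (τ n - τ 0) ^ θ := by
  induction n using Nat.strong_induction_on with
  | _ n ih =>
  intro τ hτ hΞ
  have hθ0 : θ ≠ 0 := by linarith
  have hκ := sewingConst_pos hθ
  rcases Nat.eq_zero_or_pos n with rfl | hn
  · have h := hΞ (τ 0) (τ 0) (τ 0) le_rfl le_rfl le_rfl le_rfl
    simpa [Real.zero_rpow hθ0] using h
  have h0n : τ 0 ≤ τ n := hτ hn.le
  obtain ⟨m, hm, h1, h2⟩ := hτ.exists_mem_step (c := (τ 0 + τ n) / 2) hn (by linarith)
    (by linarith)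
  obtain ⟨k, rfl⟩ : ∃ k, n = m + 1 + k := ⟨n - (m + 1), by omega⟩
  set d := τ (m + 1 + k) - τ 0 with hd
  have hd0 : 0 ≤ d := by linarith
  have h0m : τ 0 ≤ τ m := hτ (by omega)
  have hmm : τ m ≤ τ (m + 1) := hτ (by omega)
  have hmk : τ (m + 1) ≤ τ (m + 1 + k) := hτ (by omega)
  have ih1 := ih m (by omega) τ hτ fun s u t hs hu ht h =>
    hΞ s u t hs hu ht (by linarith)
  have ih2 := ih k (by omega) (fun i => τ (m + 1 + i)) (fun i j hij => hτ (by omega))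
    fun s u t hs hu ht h => hΞ s u t (by simp at hs; linarith) hu ht (by simpa using h)
  have hhalf : ∀ x, 0 ≤ x → x ≤ d / 2 →
      2 * sewingConst θ * C * x ^ θ ≤ 2 * sewingConst θ * C * (d / 2) ^ θ :=
    fun x hx hxd => by gcongr
  have ih1' := ih1.trans (hhalf _ (by linarith) (by linarith))
  have ih2' := ih2.trans (hhalf _ (by simp; linarith) (by simp; linarith))
  have d1 := hΞ (τ 0) (τ m) (τ (m + 1 + k)) le_rfl h0m (by linarith) le_rfl
  have hmd : τ (m + 1 + k) - τ m ≤ d := by linarith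
  have d2 : ‖Ξ (τ m) (τ (m + 1 + k)) - Ξ (τ m) (τ (m + 1)) - Ξ (τ (m + 1)) (τ (m + 1 + k))‖ ≤
      C * d ^ θ :=
    (hΞ (τ m) (τ (m + 1)) (τ (m + 1 + k)) h0m hmm hmk le_rfl).trans
      (mul_le_mul_of_nonneg_left (Real.rpow_le_rpow (by linarith) hmd (by linarith)) hC)
  rw [Finset.sum_range_add, Finset.sum_range_succ]
  have e := two_mul_half_rpow hd0 θ
  have e2 := sewingConst_mul hθ
  have key : 2 * sewingConst θ * C * (d / 2) ^ θ + (2 * sewingConst θ * C * (d / 2) ^ θ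
      + (C * d ^ θ + C * d ^ θ)) = 2 * sewingConst θ * C * d ^ θ := by
    linear_combination (2 * sewingConst θ * C) * e + 2 * C * d ^ θ * e2
  rw [← key]
  simp only [add_zero, ← add_assoc] at ih2'
  refine le_trans (le_of_eq ?_) ((norm_add_le _ _).trans (add_le_add ih1' <|
    (norm_add_le _ _).trans (add_le_add ih2' <|
      (norm_sub_le _ _).trans (add_le_add ((norm_neg _).trans_le d1) d2))))
  congr 1
  abel

/-- A two-parameter map of order `θ > 1` is bounded by its defect: halving the interval
repeatedly removes the a priori bound `m` and leaves only the defect. -/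
theorem norm_le_of_defect (hθ : 1 < θ) {J : ℝ → ℝ → E} {a b m : ℝ}
    (hJ : ∀ s t, a ≤ s → s ≤ t → t ≤ b → ‖J s t‖ ≤ m * (t - s) ^ θ)
    (hδ : ∀ s u t, a ≤ s → s ≤ u → u ≤ t → t ≤ b →
      ‖J s t - J s u - J u t‖ ≤ C * (t - s) ^ θ) (hab : a ≤ b) (hC : 0 ≤ C) :
    ‖J a b‖ ≤ sewingConst θ * C * (b - a) ^ θ := by
  have hκ := sewingConst_pos hθ
  have hq0 : 0 ≤ (2 : ℝ) ^ (1 - θ) := by positivity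
  have main : ∀ k : ℕ, ∀ s t, a ≤ s → s ≤ t → t ≤ b →
      ‖J s t‖ ≤ (((2 : ℝ) ^ (1 - θ)) ^ k * m + sewingConst θ * C) * (t - s) ^ θ := by
    intro k
    induction k with
    | zero =>
      intro s t hs hst ht
      refine (hJ s t hs hst ht).trans ?_
      have : 0 ≤ (t - s) := by linarith
      gcongr
      have : 0 ≤ sewingConst θ * C := by positivity
      simpa using this
    | succ k ih =>
      intro s t hs hst ht
      have h1 := ih s ((s + t) / 2) hs (by linarith) (by linarith)
      have h2 := ih ((s + t) / 2) t (by linarith) (by linarith) ht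
      have h3 := hδ s ((s + t) / 2) t hs (by linarith) (by linarith) ht
      rw [show (s + t) / 2 - s = (t - s) / 2 by ring] at h1
      rw [show t - (s + t) / 2 = (t - s) / 2 by ring] at h2
      have e := two_mul_half_rpow (sub_nonneg.2 hst) θ
      have e2 := sewingConst_mul hθ
      calc ‖J s t‖ = ‖(J s t - J s ((s + t) / 2) - J ((s + t) / 2) t) +
            J s ((s + t) / 2) + J ((s + t) / 2) t‖ := by congr 1; abel
        _ ≤ _ := norm_add₃_le
        _ ≤ _ := add_le_add (add_le_add h3 h1) h2
        _ = _ := by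
          rw [pow_succ]
          linear_combination (((2 : ℝ) ^ (1 - θ)) ^ k * m + sewingConst θ * C) * e
            + C * (t - s) ^ θ * e2
  refine ge_of_tendsto' (x := Filter.atTop) (f := fun k : ℕ =>
    (((2 : ℝ) ^ (1 - θ)) ^ k * m + sewingConst θ * C) * (b - a) ^ θ) ?_
    fun k => main k a b le_rfl hab le_rfl
  have := tendsto_pow_atTop_nhds_zero_of_lt_one hq0 (two_rpow_one_sub_lt_one hθ)
  simpa using ((this.mul_const m).add_const (sewingConst θ * C)).mul_const ((b - a) ^ θ)

theorem sum_range_two_mul (g : ℕ → E) (n : ℕ) :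
    ∑ i ∈ Finset.range (2 * n), g i = ∑ i ∈ Finset.range n, (g (2 * i) + g (2 * i + 1)) := by
  induction n with
  | zero => simp
  | succ n ih =>
    rw [Nat.mul_succ, Finset.sum_range_succ, Finset.sum_range_succ, ih, Finset.sum_range_succ,
      add_assoc]

/-- The sewing lemma: a germ on `[0, T]` with defect of order `θ > 1` is, up to order `θ`, the
increment of a path. The path is the limit of the Riemann sums along the dyadic partitions of
`[0, T]`, cut off at the endpoint. -/
theorem exists_sewing [CompleteSpace E] (hθ : 1 < θ) (hC : 0 ≤ C) {T : ℝ} (hT : 0 ≤ T)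
    (hΞ : ∀ s u t, 0 ≤ s → s ≤ u → u ≤ t → t ≤ T →
      ‖Ξ s t - Ξ s u - Ξ u t‖ ≤ C * (t - s) ^ θ) :
    ∃ I : ℝ → E, ∃ m, 0 ≤ m ∧ ∀ s t, 0 ≤ s → s ≤ t → t ≤ T →
      ‖I t - I s - Ξ s t‖ ≤ m * (t - s) ^ θ := by
  have hθ0 : θ ≠ 0 := by linarith
  have hdiag : ∀ s, 0 ≤ s → s ≤ T → Ξ s s = 0 := fun s h0 h1 => by
    simpa [Real.zero_rpow hθ0] using hΞ s s s h0 le_rfl le_rfl h1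
  -- the grid points of the `n`-th dyadic partition
  let p : ℕ → ℕ → ℝ := fun n i => i * (T / 2 ^ n)
  have hp : ∀ n, Monotone (p n) := fun n i j hij => by
    have : (i : ℝ) ≤ j := by exact_mod_cast hij
    simp only [p]; gcongr
  have hp0 : ∀ n i, 0 ≤ p n i := fun n i => by positivity
  have hpT : ∀ n, p n (2 ^ n) = T := fun n => by simp only [p]; push_cast; field_simp
  have hpsub : ∀ n i, p n (i + 1) - p n i = T / 2 ^ n := fun n i => by
    simp only [p]; push_cast; ring
  have hp2 : ∀ n i, p (n + 1) (2 * i) = p n i := fun n i => by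
    simp only [p, pow_succ]; push_cast; field_simp
  let S : ℕ → ℝ → E := fun n t =>
    ∑ i ∈ Finset.range (2 ^ n), Ξ (min t (p n i)) (min t (p n (i + 1)))
  have hq : ∀ n : ℕ, (2 : ℝ) ^ n * (C * (T / 2 ^ n) ^ θ) =
      C * T ^ θ * ((2 : ℝ) ^ (1 - θ)) ^ n := fun n => by
    rw [Real.div_rpow hT (by positivity), ← Real.rpow_natCast 2 n, ← Real.rpow_mul zero_le_two,
      ← Real.rpow_natCast ((2 : ℝ) ^ (1 - θ)) n, ← Real.rpow_mul zero_le_two,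
      show (1 - θ) * (n : ℝ) = n - n * θ by ring, Real.rpow_sub two_pos]
    field_simp
  have hcauchy : ∀ t, 0 ≤ t → t ≤ T → CauchySeq fun n => S n t := by
    intro t h0 hT'
    refine cauchySeq_of_le_geometric _ (C * T ^ θ) (two_rpow_one_sub_lt_one hθ) fun n => ?_
    rw [← hq, dist_eq_norm]
    have e : S (n + 1) t = ∑ i ∈ Finset.range (2 ^ n),
        (Ξ (min t (p n i)) (min t (p (n + 1) (2 * i + 1))) +
          Ξ (min t (p (n + 1) (2 * i + 1))) (min t (p n (i + 1)))) := by
      simp only [S]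
      rw [pow_succ', sum_range_two_mul]
      refine Finset.sum_congr rfl fun i _ => ?_
      rw [hp2, show 2 * i + 1 + 1 = 2 * (i + 1) by ring, hp2]
    rw [e]
    simp only [S]
    rw [← Finset.sum_sub_distrib]
    refine (norm_sum_le_of_le _ (f := _) (n := fun _ => C * (T / 2 ^ n) ^ θ)
      fun i _ => ?_).trans (by simp)
    have h1 : p n i ≤ p (n + 1) (2 * i + 1) := by
      rw [← hp2]; exact hp _ (by omega)
    have h2 : p (n + 1) (2 * i + 1) ≤ p n (i + 1) := by
      rw [← hp2 n (i + 1)]; exact hp _ (by omega)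
    have h3 : min t (p n i) ≤ min t (p (n + 1) (2 * i + 1)) := min_le_min le_rfl h1
    have h4 : min t (p (n + 1) (2 * i + 1)) ≤ min t (p n (i + 1)) := min_le_min le_rfl h2
    have h5 : min t (p n (i + 1)) - min t (p n i) ≤ T / 2 ^ n := by
      rw [← hpsub n i]
      rcases le_total t (p n i) with h | h
      · rw [min_eq_left h]; linarith [min_le_left t (p n (i + 1)), hp n (Nat.le_succ i)]
      · rw [min_eq_right h]; linarith [min_le_right t (p n (i + 1))]
    have h6 := hΞ _ _ _ (le_min h0 (hp0 n i)) h3 h4 ((min_le_left _ _).trans hT')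
    rw [← sub_sub]
    refine h6.trans ?_
    have : 0 ≤ min t (p n (i + 1)) - min t (p n i) := by linarith
    gcongr
  choose! I hI using fun t h0 h1 => cauchySeq_tendsto_of_complete (hcauchy t h0 h1)
  refine ⟨I, 2 * sewingConst θ * C, by have := sewingConst_pos hθ; positivity,
    fun s t hs hst ht => ?_⟩
  have hlim : Filter.Tendsto (fun n => S n t - S n s - Ξ s t) Filter.atTop
      (nhds (I t - I s - Ξ s t)) :=
    ((hI t (hs.trans hst) ht).sub (hI s hs (hst.trans ht))).sub_const _
  have hbound : ∀ n, ‖S n t - S n s - Ξ s t‖ ≤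
      2 * sewingConst θ * C * (t - s) ^ θ + C * T ^ θ * ((2 : ℝ) ^ (1 - θ)) ^ n := by
    intro n
    let τ : ℕ → ℝ := fun i => max s (min t (p n i))
    have hτ : Monotone τ := fun i j hij => max_le_max le_rfl (min_le_min le_rfl (hp n hij))
    have hτ0 : τ 0 = s := by simp [τ, p, hs]
    have hτn : τ (2 ^ n) = t := by
      simp only [τ]; rw [hpT, min_eq_left ht, max_eq_right hst]
    have h1 := norm_sum_sub_le_of_defect hθ hC (2 ^ n) τ hτ (Ξ := Ξ) (by
      rw [hτ0, hτn]
      exact fun a u b ha hau hub hb => hΞ a u b (hs.trans ha) hau hub (hb.trans ht))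
    rw [hτ0, hτn] at h1
    have h2 : ‖S n t - S n s - ∑ i ∈ Finset.range (2 ^ n), Ξ (τ i) (τ (i + 1))‖ ≤
        C * T ^ θ * ((2 : ℝ) ^ (1 - θ)) ^ n := by
      rw [← hq]
      simp only [S]
      rw [← Finset.sum_sub_distrib, ← Finset.sum_sub_distrib]
      refine (norm_sum_le_of_le _ (f := _) (n := fun _ => C * (T / 2 ^ n) ^ θ)
        fun i _ => ?_).trans (by simp)
      have hi : p n i ≤ p n (i + 1) := hp n (Nat.le_succ i)
      have hnn : 0 ≤ C * (T / 2 ^ n) ^ θ := by positivity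
      simp only [τ]
      rcases le_total (p n (i + 1)) s with h | h
      · rw [min_eq_right (h.trans hst), min_eq_right (hi.trans (h.trans hst)), min_eq_right h,
          min_eq_right (hi.trans h), max_eq_left h, max_eq_left (hi.trans h),
          hdiag s hs (hst.trans ht)]
        simpa using hnn
      rcases le_total s (p n i) with h' | h'
      · rw [min_eq_left h, min_eq_left h', max_eq_right (le_min hst h),
          max_eq_right (le_min hst h'), hdiag s hs (hst.trans ht)]
        simpa using hnn
      · rw [min_eq_left h, min_eq_right h', min_eq_right (h'.trans hst), max_eq_left h',
          max_eq_right (le_min hst h)]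
        refine (hΞ _ _ _ (hp0 n i) h' (le_min hst h) ((min_le_left _ _).trans ht)).trans ?_
        have h7 : min t (p n (i + 1)) - p n i ≤ T / 2 ^ n := by
          rw [← hpsub n i]; linarith [min_le_right t (p n (i + 1))]
        have : 0 ≤ min t (p n (i + 1)) - p n i := by
          linarith [le_min hst h]
        gcongr
    calc _ = ‖(∑ i ∈ Finset.range (2 ^ n), Ξ (τ i) (τ (i + 1)) - Ξ s t) +
          (S n t - S n s - ∑ i ∈ Finset.range (2 ^ n), Ξ (τ i) (τ (i + 1)))‖ := by
          congr 1; abel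
      _ ≤ _ := (norm_add_le _ _).trans (add_le_add h1 h2)
  refine le_of_tendsto_of_tendsto' hlim.norm ?_ hbound
  have := tendsto_pow_atTop_nhds_zero_of_lt_one (by positivity) (two_rpow_one_sub_lt_one hθ)
  simpa using (this.const_mul (C * T ^ θ)).const_add (2 * sewingConst θ * C * (t - s) ^ θ)

end Sewing

/-! ### Quantitative hypotheses -/

section Setting

variable {V W : Type*} [NormedAddCommGroup V] [NormedSpace ℝ V]
  [NormedAddCommGroup W] [NormedSpace ℝ W]

/-- A rough path whose Hölder norms are at most `Λ`. Bounds are stated for ordered times `s ≤ t`,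
and in powers of `(t - s) ^ β`, so that later estimates are polynomial in this quantity. -/
structure RoughBound (β T Λ : ℝ) (X : ℝ → V) (XX : ℝ → ℝ → ProjTensor V) : Prop where
  path : ∀ s t, 0 ≤ s → s ≤ t → t ≤ T → ‖X t - X s‖ ≤ Λ * (t - s) ^ β
  area : ∀ s t, 0 ≤ s → s ≤ t → t ≤ T → ‖XX s t‖ ≤ Λ * ((t - s) ^ β) ^ 2
  chen : ∀ s u t, 0 ≤ s → s ≤ u → u ≤ t → t ≤ T →
    XX s t - XX s u - XX u t = elemTensor (X u - X s) (X t - X u)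

/-- A time-dependent vector field with all norms of `C_b^{2β,3}` at most `Λ`. The bound on the
third derivative enters as a Lipschitz bound on the second one. -/
structure FieldBound {E : Type*} [NormedAddCommGroup E] [NormedSpace ℝ E]
    (β T Λ : ℝ) (f : ℝ → W → E) : Prop where
  norm_le : ∀ t ∈ Icc 0 T, ∀ y, ‖f t y‖ ≤ Λ
  norm_fderiv_le : ∀ t ∈ Icc 0 T, ∀ y, ‖fderiv ℝ (f t) y‖ ≤ Λ
  norm_fderiv_fderiv_le : ∀ t ∈ Icc 0 T, ∀ y, ‖fderiv ℝ (fderiv ℝ (f t)) y‖ ≤ Λ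
  hasFDerivAt : ∀ t ∈ Icc 0 T, ∀ y, HasFDerivAt (f t) (fderiv ℝ (f t) y) y
  hasFDerivAt_fderiv : ∀ t ∈ Icc 0 T, ∀ y,
    HasFDerivAt (fderiv ℝ (f t)) (fderiv ℝ (fderiv ℝ (f t)) y) y
  fderiv_fderiv_sub_le : ∀ t ∈ Icc 0 T, ∀ y z,
    ‖fderiv ℝ (fderiv ℝ (f t)) y - fderiv ℝ (fderiv ℝ (f t)) z‖ ≤ Λ * ‖y - z‖
  time : ∀ s ∈ Icc 0 T, ∀ t ∈ Icc 0 T, s ≤ t → ∀ y,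
    ‖f t y - f s y‖ ≤ Λ * ((t - s) ^ β) ^ 2
  time_fderiv : ∀ s ∈ Icc 0 T, ∀ t ∈ Icc 0 T, s ≤ t → ∀ y,
    ‖fderiv ℝ (f t) y - fderiv ℝ (f s) y‖ ≤ Λ * ((t - s) ^ β) ^ 2
  time_fderiv_fderiv : ∀ s ∈ Icc 0 T, ∀ t ∈ Icc 0 T, s ≤ t → ∀ y,
    ‖fderiv ℝ (fderiv ℝ (f t)) y - fderiv ℝ (fderiv ℝ (f s)) y‖ ≤ Λ * ((t - s) ^ β) ^ 2

/-- A drift with Lipschitz constant and linear growth constant at most `Λ`. -/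
structure DriftBound (T Λ : ℝ) (f₀ : ℝ → W → W) : Prop where
  continuousOn : ContinuousOn (fun p : ℝ × W => f₀ p.1 p.2) (Icc 0 T ×ˢ univ)
  lipschitz : ∀ t ∈ Icc 0 T, ∀ y z, ‖f₀ t y - f₀ t z‖ ≤ Λ * ‖y - z‖
  growth : ∀ t ∈ Icc 0 T, ∀ y, ‖f₀ t y‖ ≤ Λ * (1 + ‖y‖)

/-- The data of the equation, with one constant `Λ ≥ 1` that bounds all of it. The bound `sub_le`
expresses `2β ≤ 1`: the drift is at least as regular as the second-order terms. -/
structure RodeBound (β T Λ : ℝ) (X : ℝ → V) (XX : ℝ → ℝ → ProjTensor V) (f₀ : ℝ → W → W)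
    (f : ℝ → W → V →L[ℝ] W) : Prop where
  one_le : 1 ≤ Λ
  rpow_le : ∀ s t, 0 ≤ s → s ≤ t → t ≤ T → (t - s) ^ β ≤ Λ
  sub_le : ∀ s t, 0 ≤ s → s ≤ t → t ≤ T → t - s ≤ Λ * ((t - s) ^ β) ^ 2
  rough : RoughBound β T Λ X XX
  field : FieldBound β T Λ f
  drift : DriftBound T Λ f₀

theorem rpow_mul_two_of_nonneg {d : ℝ} (hd : 0 ≤ d) (β : ℝ) : d ^ (2 * β) = (d ^ β) ^ 2 := by
  rw [mul_comm, Real.rpow_mul hd, Real.rpow_two]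

theorem rpow_mul_three_of_nonneg {d : ℝ} (hd : 0 ≤ d) (β : ℝ) : d ^ (3 * β) = (d ^ β) ^ 3 := by
  rw [mul_comm, Real.rpow_mul hd, ← Real.rpow_natCast _ 3]; norm_num

theorem FiniteHolder.exists_bound {E : Type*} [NormedAddCommGroup E] {γ T : ℝ}
    {Ξ : ℝ → ℝ → E} (h : FiniteHolder γ T Ξ) (h0 : ∀ s ∈ Icc 0 T, Ξ s s = 0) :
    ∃ C, ∀ Λ ≥ C, ∀ s t, 0 ≤ s → s ≤ t → t ≤ T → ‖Ξ s t‖ ≤ Λ * (t - s) ^ γ := by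
  obtain ⟨C, hC⟩ := h
  refine ⟨max C 0, fun Λ hΛ s t hs hst ht => ?_⟩
  have hΛ0 : 0 ≤ Λ := (le_max_right _ _).trans hΛ
  have hd : 0 ≤ t - s := sub_nonneg.2 hst
  rcases hst.eq_or_lt with rfl | hlt
  · rw [h0 s ⟨hs, ht⟩, norm_zero]; positivity
  · have := hC s ⟨hs, hst.trans ht⟩ t ⟨hs.trans hst, ht⟩ hlt.ne
    rw [abs_of_nonneg hd] at this
    exact this.trans (by gcongr; exact (le_max_left _ _).trans hΛ)

theorem IsRoughPath.exists_roughBound {β T : ℝ} {X : ℝ → V} {XX : ℝ → ℝ → ProjTensor V}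
    (h : IsRoughPath β T X XX) : ∃ C, ∀ Λ ≥ C, RoughBound β T Λ X XX := by
  obtain ⟨C₁, h₁⟩ := h.holder_path.exists_bound (by simp)
  obtain ⟨C₂, h₂⟩ := h.holder_area.exists_bound fun s hs => by
    have := h.chen s hs s hs s hs
    rw [sub_self, sub_self, elemTensor_zero_left, zero_sub, neg_eq_zero] at this
    exact this
  refine ⟨max C₁ C₂, fun Λ hΛ => ⟨h₁ Λ ((le_max_left _ _).trans hΛ), fun s t hs hst ht => ?_,
    fun s u t hs hsu hut ht => h.chen s ⟨hs, by linarith⟩ u ⟨by linarith, by linarith⟩ t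
      ⟨by linarith, ht⟩⟩⟩
  rw [← rpow_mul_two_of_nonneg (sub_nonneg.2 hst)]
  exact h₂ Λ ((le_max_right _ _).trans hΛ) s t hs hst ht

theorem IsLip.exists_driftBound {W : Type*} [NormedAddCommGroup W] {T : ℝ} {f₀ : ℝ → W → W} (h : IsLip T f₀) :
    ∃ C, ∀ Λ ≥ C, DriftBound T Λ f₀ := by
  obtain ⟨L, hL⟩ := h.lipschitz
  obtain ⟨C, hC⟩ := isCompact_Icc.exists_bound_of_continuousOn (f := fun t => f₀ t 0)
    (h.continuousOn.comp (f := fun t => (t, (0 : W))) (by fun_prop) fun t ht => ⟨ht, mem_univ _⟩)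
  refine ⟨max L C, fun Λ hΛ => ?_⟩
  have hlip : ∀ t ∈ Icc 0 T, ∀ y z, ‖f₀ t y - f₀ t z‖ ≤ Λ * ‖y - z‖ := fun t ht y z =>
    (hL t ht y z).trans (by gcongr; exact (le_max_left _ _).trans hΛ)
  refine ⟨h.continuousOn, hlip, fun t ht y => ?_⟩
  have h1 := hlip t ht y 0
  have h2 := (hC t ht).trans ((le_max_right _ _).trans hΛ)
  rw [sub_zero] at h1
  linarith [norm_le_norm_add_norm_sub' (f₀ t y) (f₀ t 0)]

theorem norm_fderiv_fderiv {E : Type*} [NormedAddCommGroup E] [NormedSpace ℝ E] (g : W → E)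
    (y : W) : ‖fderiv ℝ (fderiv ℝ g) y‖ = ‖iteratedFDeriv ℝ 2 g y‖ := by
  rw [← norm_iteratedFDeriv_one, norm_iteratedFDeriv_fderiv]

theorem IsCb.exists_fieldBound {E : Type*} [NormedAddCommGroup E] [NormedSpace ℝ E] {β T : ℝ}
    {f : ℝ → W → E} (h : IsCb (2 * β) 3 T f) : ∃ C, ∀ Λ ≥ C, FieldBound β T Λ f := by
  obtain ⟨C₁, h₁⟩ := h.bounded
  obtain ⟨C₂, h₂⟩ := h.holder
  refine ⟨max C₁ C₂, fun Λ hΛ => ?_⟩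
  have hC₁ : C₁ ≤ Λ := (le_max_left _ _).trans hΛ
  have hC₂ : C₂ ≤ Λ := (le_max_right _ _).trans hΛ
  have hd1 : ∀ t ∈ Icc 0 T, Differentiable ℝ (f t) := fun t ht =>
    (h.contDiff t ht).differentiable (by norm_num)
  have hc2 : ∀ t ∈ Icc 0 T, ContDiff ℝ 2 (fderiv ℝ (f t)) := fun t ht =>
    (h.contDiff t ht).fderiv_right (by norm_num)
  have hd2 : ∀ t ∈ Icc 0 T, Differentiable ℝ (fderiv ℝ (f t)) := fun t ht =>
    (hc2 t ht).differentiable (by norm_num)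
  have hd3 : ∀ t ∈ Icc 0 T, Differentiable ℝ (fderiv ℝ (fderiv ℝ (f t))) := fun t ht =>
    ((hc2 t ht).fderiv_right (m := 1) (by norm_num)).differentiable (by norm_num)
  have htime : ∀ k < 3, ∀ s ∈ Icc 0 T, ∀ t ∈ Icc 0 T, s ≤ t → ∀ y,
      ‖iteratedFDeriv ℝ k (f t - f s) y‖ ≤ Λ * ((t - s) ^ β) ^ 2 := by
    intro k hk s hs t ht hst y
    have hk' : (k : WithTop ℕ∞) ≤ (3 : ℕ) := by exact_mod_cast hk.le
    rw [iteratedFDeriv_sub_apply ((h.contDiff t ht).of_le hk').contDiffAt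
      ((h.contDiff s hs).of_le hk').contDiffAt, ← rpow_mul_two_of_nonneg (sub_nonneg.2 hst)]
    refine (h₂ k hk y s hs t ht).trans ?_
    rw [abs_of_nonneg (sub_nonneg.2 hst)]
    have := sub_nonneg.2 hst
    gcongr
  have hsub : ∀ s ∈ Icc 0 T, ∀ t ∈ Icc 0 T,
      fderiv ℝ (f t - f s) = fderiv ℝ (f t) - fderiv ℝ (f s) := fun s hs t ht => by
    ext1 y
    exact fderiv_sub (hd1 t ht y) (hd1 s hs y)
  refine ⟨fun t ht y => ?_, fun t ht y => ?_, fun t ht y => ?_, fun t ht y =>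
    (hd1 t ht y).hasFDerivAt, fun t ht y => (hd2 t ht y).hasFDerivAt, fun t ht y z => ?_,
    fun s hs t ht hst y => ?_, fun s hs t ht hst y => ?_, fun s hs t ht hst y => ?_⟩
  · simpa using (h₁ t ht 0 (by norm_num) y).trans hC₁
  · rw [← norm_iteratedFDeriv_one]
    exact (h₁ t ht 1 (by norm_num) y).trans hC₁
  · rw [norm_fderiv_fderiv]
    exact (h₁ t ht 2 (by norm_num) y).trans hC₁
  · refine norm_sub_le_of_hasFDerivAt (g' := fderiv ℝ (fderiv ℝ (fderiv ℝ (f t))))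
      (fun y => (hd3 t ht y).hasFDerivAt) (fun y => ?_) y z
    rw [norm_fderiv_fderiv, norm_iteratedFDeriv_fderiv]
    exact (h₁ t ht 3 le_rfl y).trans hC₁
  · simpa using htime 0 (by norm_num) s hs t ht hst y
  · have := htime 1 (by norm_num) s hs t ht hst y
    rwa [norm_iteratedFDeriv_one, hsub s hs t ht] at this
  · have := htime 2 (by norm_num) s hs t ht hst y
    rw [← norm_fderiv_fderiv, hsub s hs t ht] at this
    rwa [fderiv_sub (hd2 t ht y) (hd2 s hs y)] at this

theorem exists_rodeBound {β T : ℝ} (hβ : β ∈ Ioc (1 / 3 : ℝ) (1 / 2)) (hT : 0 ≤ T)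
    {X : ℝ → V} {XX : ℝ → ℝ → ProjTensor V} (hX : IsRoughPath β T X XX)
    {f₀ : ℝ → W → W} (hf₀ : IsLip T f₀) {f : ℝ → W → V →L[ℝ] W} (hf : IsCb (2 * β) 3 T f) :
    ∃ C, ∀ Λ ≥ C, RodeBound β T Λ X XX f₀ f := by
  obtain ⟨C₁, h₁⟩ := hX.exists_roughBound
  obtain ⟨C₂, h₂⟩ := hf₀.exists_driftBound
  obtain ⟨C₃, h₃⟩ := hf.exists_fieldBound
  have hβ1 := hβ.1
  have hβ2 := hβ.2
  have hpow : ∀ d γ : ℝ, 0 ≤ d → d ≤ T → 0 ≤ γ → γ ≤ 1 → d ^ γ ≤ 1 + T := by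
    intro d γ hd hdT hγ hγ1
    calc d ^ γ ≤ (1 + T) ^ γ := by gcongr; linarith
      _ ≤ (1 + T) ^ (1 : ℝ) := Real.rpow_le_rpow_of_exponent_le (by linarith) hγ1
      _ = _ := Real.rpow_one _
  refine ⟨max (1 + T) (max C₁ (max C₂ C₃)), fun Λ hΛ => ?_⟩
  simp only [ge_iff_le, max_le_iff] at hΛ
  obtain ⟨hΛT, hΛ₁, hΛ₂, hΛ₃⟩ := hΛ
  refine ⟨by linarith, fun s t hs hst ht => ?_, fun s t hs hst ht => ?_, h₁ Λ hΛ₁, h₃ Λ hΛ₃,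
    h₂ Λ hΛ₂⟩
  · exact (hpow _ _ (by linarith) (by linarith) (by linarith) (by linarith)).trans hΛT
  · rcases hst.eq_or_lt with rfl | hlt
    · rw [sub_self]
      exact mul_nonneg (by linarith) (sq_nonneg _)
    · have hd : 0 < t - s := sub_pos.2 hlt
      calc t - s = (t - s) ^ (1 - 2 * β) * (t - s) ^ (2 * β) := by
            rw [← Real.rpow_add hd]; simp
        _ ≤ _ := by
          rw [rpow_mul_two_of_nonneg hd.le]
          gcongr
          exact (hpow _ _ hd.le (by linarith) (by linarith) (by linarith)).trans hΛT

end Setting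

/-! ### Composition with the vector field -/

section Composition

variable {V W : Type*} [NormedAddCommGroup V] [NormedSpace ℝ V]
  [NormedAddCommGroup W] [NormedSpace ℝ W]
  {β T Λ : ℝ} {f : ℝ → W → V →L[ℝ] W}

theorem norm_add₃_le_of_le {E : Type*} [SeminormedAddCommGroup E] {a b c : E} {x y z : ℝ}
    (ha : ‖a‖ ≤ x) (hb : ‖b‖ ≤ y) (hc : ‖c‖ ≤ z) : ‖a + b + c‖ ≤ x + y + z :=
  norm_add₃_le.trans (by linarith)

theorem norm_add₄_le_of_le {E : Type*} [SeminormedAddCommGroup E] {a b c d : E} {x y z w : ℝ}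
    (ha : ‖a‖ ≤ x) (hb : ‖b‖ ≤ y) (hc : ‖c‖ ≤ z) (hd : ‖d‖ ≤ w) :
    ‖a + b + c + d‖ ≤ x + y + z + w :=
  norm_add₄_le.trans (by linarith)

theorem ContinuousLinearMap.norm_comp_le_of_le {E F G : Type*} [NormedAddCommGroup E]
    [NormedSpace ℝ E] [NormedAddCommGroup F] [NormedSpace ℝ F] [NormedAddCommGroup G]
    [NormedSpace ℝ G] {A : F →L[ℝ] G} {B : E →L[ℝ] F} {a b : ℝ} (hA : ‖A‖ ≤ a) (hB : ‖B‖ ≤ b) :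
    ‖A.comp B‖ ≤ a * b :=
  (A.opNorm_comp_le B).trans (mul_le_mul hA hB (norm_nonneg B) ((norm_nonneg A).trans hA))

theorem FieldBound.lipschitz {E : Type*} [NormedAddCommGroup E] [NormedSpace ℝ E]
    {f : ℝ → W → E} (hf : FieldBound β T Λ f) {t : ℝ} (ht : t ∈ Icc 0 T) (y z : W) :
    ‖f t y - f t z‖ ≤ Λ * ‖y - z‖ :=
  norm_sub_le_of_hasFDerivAt (hf.hasFDerivAt t ht) (hf.norm_fderiv_le t ht) y z

theorem FieldBound.lipschitz_fderiv {E : Type*} [NormedAddCommGroup E] [NormedSpace ℝ E]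
    {f : ℝ → W → E} (hf : FieldBound β T Λ f) {t : ℝ} (ht : t ∈ Icc 0 T) (y z : W) :
    ‖fderiv ℝ (f t) y - fderiv ℝ (f t) z‖ ≤ Λ * ‖y - z‖ :=
  norm_sub_le_of_hasFDerivAt (hf.hasFDerivAt_fderiv t ht) (hf.norm_fderiv_fderiv_le t ht) y z

/-- The four-point inequality for `f`, with the time dependence taken into account. -/
theorem FieldBound.norm_four_point_le {E : Type*} [NormedAddCommGroup E] [NormedSpace ℝ E]
    {f : ℝ → W → E} (hf : FieldBound β T Λ f) {s t : ℝ} (hs : s ∈ Icc 0 T) (ht : t ∈ Icc 0 T)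
    (hst : s ≤ t) (y₀ y₁ z₀ z₁ : W) :
    ‖(f t y₁ - f t z₁) - (f s y₀ - f s z₀)‖ ≤ Λ * ((t - s) ^ β) ^ 2 * ‖y₁ - z₁‖ +
      (Λ * ‖(y₁ - z₁) - (y₀ - z₀)‖ + Λ * ‖y₁ - y₀‖ * ‖y₀ - z₀‖) := by
  have h1 : ‖(f t y₁ - f s y₁) - (f t z₁ - f s z₁)‖ ≤ Λ * ((t - s) ^ β) ^ 2 * ‖y₁ - z₁‖ :=
    norm_sub_le_of_hasFDerivAt (g := fun y => f t y - f s y)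
      (g' := fun y => fderiv ℝ (f t) y - fderiv ℝ (f s) y)
      (fun y => (hf.hasFDerivAt t ht y).sub (hf.hasFDerivAt s hs y))
      (hf.time_fderiv s hs t ht hst) y₁ z₁
  have h2 := norm_sub_sub_sub_le_of_hasFDerivAt (hf.hasFDerivAt s hs) (hf.norm_fderiv_le s hs)
    (hf.lipschitz_fderiv hs) y₀ y₁ z₀ z₁
  calc _ = ‖((f t y₁ - f s y₁) - (f t z₁ - f s z₁)) +
        ((f s y₁ - f s z₁) - (f s y₀ - f s z₀))‖ := by congr 1; abel
    _ ≤ _ := (norm_add_le _ _).trans (add_le_add h1 h2)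

/-- The four-point inequality for the space derivative of `f`. -/
theorem FieldBound.norm_four_point_fderiv_le {E : Type*} [NormedAddCommGroup E] [NormedSpace ℝ E]
    {f : ℝ → W → E} (hf : FieldBound β T Λ f) {s t : ℝ} (hs : s ∈ Icc 0 T) (ht : t ∈ Icc 0 T)
    (hst : s ≤ t) (y₀ y₁ z₀ z₁ : W) :
    ‖(fderiv ℝ (f t) y₁ - fderiv ℝ (f t) z₁) - (fderiv ℝ (f s) y₀ - fderiv ℝ (f s) z₀)‖ ≤
      Λ * ((t - s) ^ β) ^ 2 * ‖y₁ - z₁‖ +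
      (Λ * ‖(y₁ - z₁) - (y₀ - z₀)‖ + Λ * ‖y₁ - y₀‖ * ‖y₀ - z₀‖) := by
  have h1 : ‖(fderiv ℝ (f t) y₁ - fderiv ℝ (f s) y₁) -
      (fderiv ℝ (f t) z₁ - fderiv ℝ (f s) z₁)‖ ≤ Λ * ((t - s) ^ β) ^ 2 * ‖y₁ - z₁‖ :=
    norm_sub_le_of_hasFDerivAt (g := fun y => fderiv ℝ (f t) y - fderiv ℝ (f s) y)
      (g' := fun y => fderiv ℝ (fderiv ℝ (f t)) y - fderiv ℝ (fderiv ℝ (f s)) y)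
      (fun y => (hf.hasFDerivAt_fderiv t ht y).sub (hf.hasFDerivAt_fderiv s hs y))
      (hf.time_fderiv_fderiv s hs t ht hst) y₁ z₁
  have h2 := norm_sub_sub_sub_le_of_hasFDerivAt (hf.hasFDerivAt_fderiv s hs)
    (hf.norm_fderiv_fderiv_le s hs) (hf.fderiv_fderiv_sub_le s hs) y₀ y₁ z₀ z₁
  calc _ = ‖((fderiv ℝ (f t) y₁ - fderiv ℝ (f s) y₁) - (fderiv ℝ (f t) z₁ - fderiv ℝ (f s) z₁)) +
        ((fderiv ℝ (f s) y₁ - fderiv ℝ (f s) z₁) - (fderiv ℝ (f s) y₀ - fderiv ℝ (f s) z₀))‖ := by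
        congr 1; abel
    _ ≤ _ := (norm_add_le _ _).trans (add_le_add h1 h2)

/-- The increment of `f t (Y t)` when `Y` is controlled: the bound on the remainder is linear in
the bound `Q` on the remainder of `Y`, because only the second-order part of the increment of `Y`
enters quadratically. -/
theorem FieldBound.norm_comp_remainder_le (hf : FieldBound β T Λ f) (hΛ : 0 ≤ Λ) {s t : ℝ}
    (hs : s ∈ Icc 0 T) (ht : t ∈ Icc 0 T) (hst : s ≤ t) {x M Q : ℝ} (hx : x = (t - s) ^ β)
    {ΔX : V} (hΔ : ‖ΔX‖ ≤ Λ * x) {y₀ y₁ : W} {y₀' : V →L[ℝ] W} (h₀ : ‖y₀'‖ ≤ M)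
    (hR : ‖y₁ - y₀ - y₀' ΔX‖ ≤ Q * x ^ 2) :
    ‖f t y₁ - f s y₀ - ((fderiv ℝ (f s) y₀).comp y₀') ΔX‖ ≤
      Λ * (1 + Q + (M * Λ) ^ 2) * x ^ 2 := by
  have hp : ‖y₀' ΔX‖ ≤ M * (Λ * x) :=
    (y₀'.le_opNorm _).trans (mul_le_mul h₀ hΔ (norm_nonneg _) ((norm_nonneg _).trans h₀))
  have h1 := hf.time s hs t ht hst y₁
  have h2 := hf.lipschitz hs y₁ (y₀ + y₀' ΔX)
  rw [← sub_sub] at h2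
  have h3 := norm_taylor_le_of_hasFDerivAt hΛ (hf.hasFDerivAt s hs) (hf.lipschitz_fderiv hs)
    y₀ (y₀' ΔX)
  rw [← hx] at h1
  have h2' := h2.trans (mul_le_mul_of_nonneg_left hR hΛ)
  have hp0 : 0 ≤ M * (Λ * x) := (norm_nonneg _).trans hp
  have h3' : Λ * ‖y₀' ΔX‖ * ‖y₀' ΔX‖ ≤ Λ * (M * (Λ * x)) * (M * (Λ * x)) := by gcongr
  calc _ = ‖(f t y₁ - f s y₁) + (f s y₁ - f s (y₀ + y₀' ΔX)) +
        (f s (y₀ + y₀' ΔX) - f s y₀ - fderiv ℝ (f s) y₀ (y₀' ΔX))‖ := by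
        rw [ContinuousLinearMap.comp_apply]; congr 1; abel
    _ ≤ _ := norm_add₃_le_of_le h1 h2' (h3.trans h3')
    _ = _ := by ring

theorem norm_increment_le_of_remainder {ΔX : V} {x M Λ Q : ℝ} (hΔ : ‖ΔX‖ ≤ Λ * x) {p : W}
    {y' : V →L[ℝ] W} (h₀ : ‖y'‖ ≤ M) (hR : ‖p - y' ΔX‖ ≤ Q * x ^ 2) :
    ‖p‖ ≤ (M * Λ + Q * x) * x := by
  have hp : ‖y' ΔX‖ ≤ M * (Λ * x) :=
    (y'.le_opNorm _).trans (mul_le_mul h₀ hΔ (norm_nonneg _) ((norm_nonneg _).trans h₀))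
  have := norm_le_norm_add_norm_sub' p (y' ΔX)
  linarith [this, show (M * Λ + Q * x) * x = M * (Λ * x) + Q * x ^ 2 by ring]

theorem FieldBound.norm_comp_deriv_le (hf : FieldBound β T Λ f) (hΛ : 0 ≤ Λ) {s t : ℝ}
    (hs : s ∈ Icc 0 T) (ht : t ∈ Icc 0 T) (hst : s ≤ t) {x M N P : ℝ} (hx : x = (t - s) ^ β)
    {y₀ y₁ : W} {y₀' y₁' : V →L[ℝ] W} (h₁ : ‖y₁'‖ ≤ M)
    (h' : ‖y₁' - y₀'‖ ≤ P * x) (hN : ‖y₁ - y₀‖ ≤ N * x) :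
    ‖(fderiv ℝ (f t) y₁).comp y₁' - (fderiv ℝ (f s) y₀).comp y₀'‖ ≤
      (Λ * (x + N) * M + Λ * P) * x := by
  have hM : 0 ≤ M := (norm_nonneg _).trans h₁
  have h1 := hf.time_fderiv s hs t ht hst y₁
  have h2 := (hf.lipschitz_fderiv hs y₁ y₀).trans (mul_le_mul_of_nonneg_left hN hΛ)
  rw [← hx] at h1
  have h3 : ‖fderiv ℝ (f t) y₁ - fderiv ℝ (f s) y₀‖ ≤ Λ * x ^ 2 + Λ * (N * x) := by
    rw [← sub_add_sub_cancel _ (fderiv ℝ (f s) y₁)]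
    exact (norm_add_le _ _).trans (add_le_add h1 h2)
  have h4 := ContinuousLinearMap.norm_comp_le_of_le h3 h₁
  have h5 := ContinuousLinearMap.norm_comp_le_of_le (hf.norm_fderiv_le s hs y₀) h'
  calc _ = ‖(fderiv ℝ (f t) y₁ - fderiv ℝ (f s) y₀).comp y₁' +
        (fderiv ℝ (f s) y₀).comp (y₁' - y₀')‖ := by
        rw [ContinuousLinearMap.sub_comp, ContinuousLinearMap.comp_sub]; congr 1; abel
    _ ≤ _ := (norm_add_le _ _).trans (add_le_add h4 h5)
    _ = _ := by ring

/-- Two controlled paths at the times `s ≤ t`, seen through their values `y₀, y₁` and `z₀, z₁` and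
their Gubinelli derivatives, with controlled norms at most `K` and with distances
`α, α', ρ, σ` in the components of the controlled norm. Here `x` stands for `(t - s) ^ β`. -/
structure PairBound (K x α α' ρ σ : ℝ) (ΔX : V) (y₀ y₁ z₀ z₁ : W)
    (y₀' y₁' z₀' z₁' : V →L[ℝ] W) : Prop where
  x_nonneg : 0 ≤ x
  x_le : x ≤ K
  one_le : 1 ≤ K
  norm_le : ‖ΔX‖ ≤ K * x
  left_deriv₀ : ‖y₀'‖ ≤ K
  left_deriv₁ : ‖y₁'‖ ≤ K
  right_deriv₀ : ‖z₀'‖ ≤ K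
  left_deriv_sub : ‖y₁' - y₀'‖ ≤ K * x
  left_remainder : ‖y₁ - y₀ - y₀' ΔX‖ ≤ K * x ^ 2
  right_remainder : ‖z₁ - z₀ - z₀' ΔX‖ ≤ K * x ^ 2
  diff₀ : ‖y₀ - z₀‖ ≤ α
  diff₁ : ‖y₁ - z₁‖ ≤ α
  diff_deriv₀ : ‖y₀' - z₀'‖ ≤ α'
  diff_deriv₁ : ‖y₁' - z₁'‖ ≤ α'
  diff_deriv_sub : ‖(y₁' - z₁') - (y₀' - z₀')‖ ≤ ρ * x
  diff_remainder : ‖(y₁ - z₁) - (y₀ - z₀) - (y₀' - z₀') ΔX‖ ≤ σ * x ^ 2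

namespace PairBound

variable {K x α α' ρ σ : ℝ} {ΔX : V} {y₀ y₁ z₀ z₁ : W} {y₀' y₁' z₀' z₁' : V →L[ℝ] W}

theorem left_increment (h : PairBound K x α α' ρ σ ΔX y₀ y₁ z₀ z₁ y₀' y₁' z₀' z₁') :
    ‖y₁ - y₀‖ ≤ 2 * K ^ 2 * x := by
  have hK := h.one_le
  have hx := h.x_nonneg
  refine (norm_increment_le_of_remainder h.norm_le h.left_deriv₀ h.left_remainder).trans ?_
  gcongr
  nlinarith [h.x_le]

theorem right_increment (h : PairBound K x α α' ρ σ ΔX y₀ y₁ z₀ z₁ y₀' y₁' z₀' z₁') :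
    ‖z₁ - z₀‖ ≤ 2 * K ^ 2 * x := by
  have hK := h.one_le
  have hx := h.x_nonneg
  refine (norm_increment_le_of_remainder h.norm_le h.right_deriv₀ h.right_remainder).trans ?_
  gcongr
  nlinarith [h.x_le]

theorem diff_increment (h : PairBound K x α α' ρ σ ΔX y₀ y₁ z₀ z₁ y₀' y₁' z₀' z₁') :
    ‖(y₁ - z₁) - (y₀ - z₀)‖ ≤ (α' * K + σ * x) * x :=
  norm_increment_le_of_remainder h.norm_le h.diff_deriv₀ h.diff_remainder

/-- The right-hand side of the four-point inequality, in terms of the distances. -/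
theorem four_point_bound (h : PairBound K x α α' ρ σ ΔX y₀ y₁ z₀ z₁ y₀' y₁' z₀' z₁')
    (hσ : 0 ≤ σ) :
    K * x ^ 2 * ‖y₁ - z₁‖ +
      (K * ‖(y₁ - z₁) - (y₀ - z₀)‖ + K * ‖y₁ - y₀‖ * ‖y₀ - z₀‖) ≤
    3 * K ^ 3 * (α + α' + σ * x) * x := by
  have hK := h.one_le
  have hx := h.x_nonneg
  have hxK := h.x_le
  have hα : 0 ≤ α := (norm_nonneg _).trans h.diff₀
  have hα' : 0 ≤ α' := (norm_nonneg _).trans h.diff_deriv₀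
  have h1 : K * x ^ 2 * ‖y₁ - z₁‖ ≤ K * (K * x) * α := by
    have := h.diff₁
    rw [pow_two]; gcongr
  have h2 := mul_le_mul_of_nonneg_left h.diff_increment (by linarith : 0 ≤ K)
  have h3 : K * ‖y₁ - y₀‖ * ‖y₀ - z₀‖ ≤ K * (2 * K ^ 2 * x) * α := by
    have := h.diff₀
    have := h.left_increment
    gcongr
  have e1 : K ≤ K ^ 3 := le_self_pow₀ hK (by norm_num)
  have e2 : K ^ 2 ≤ K ^ 3 := pow_le_pow_right₀ hK (by norm_num)
  have e3 : 0 ≤ K ^ 3 := by positivity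
  calc _ ≤ K * (K * x) * α + (K * ((α' * K + σ * x) * x) + K * (2 * K ^ 2 * x) * α) := by
        linarith
    _ = (K ^ 2 * α + K ^ 2 * α' + K * (σ * x) + 2 * K ^ 3 * α) * x := by ring
    _ ≤ (K ^ 3 * α + 3 * K ^ 3 * α' + 3 * K ^ 3 * (σ * x) + 2 * K ^ 3 * α) * x := by
        gcongr <;> nlinarith
    _ = _ := by ring

theorem norm_field_sub_le (h : PairBound K x α α' ρ σ ΔX y₀ y₁ z₀ z₁ y₀' y₁' z₀' z₁')
    (hf : FieldBound β T K f) {s t : ℝ} (hs : s ∈ Icc 0 T) (ht : t ∈ Icc 0 T) (hst : s ≤ t)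
    (hx : x = (t - s) ^ β) (hσ : 0 ≤ σ) :
    ‖(f t y₁ - f t z₁) - (f s y₀ - f s z₀)‖ ≤ 3 * K ^ 3 * (α + α' + σ * x) * x := by
  have := hf.norm_four_point_le hs ht hst y₀ y₁ z₀ z₁
  rw [← hx] at this
  exact this.trans (h.four_point_bound hσ)

theorem norm_fderiv_comp_sub_le (h : PairBound K x α α' ρ σ ΔX y₀ y₁ z₀ z₁ y₀' y₁' z₀' z₁')
    (hf : FieldBound β T K f) {s t : ℝ} (hs : s ∈ Icc 0 T) (ht : t ∈ Icc 0 T) (hst : s ≤ t)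
    (hx : x = (t - s) ^ β) (hσ : 0 ≤ σ) (hρ : 0 ≤ ρ) :
    ‖((fderiv ℝ (f t) y₁).comp y₁' - (fderiv ℝ (f t) z₁).comp z₁') -
        ((fderiv ℝ (f s) y₀).comp y₀' - (fderiv ℝ (f s) z₀).comp z₀')‖ ≤
      9 * K ^ 5 * (α + α' + ρ + σ) * x := by
  have hK := h.one_le
  have hK0 : 0 ≤ K := by linarith
  have hx0 := h.x_nonneg
  have hxK := h.x_le
  have hα : 0 ≤ α := (norm_nonneg _).trans h.diff₀
  have hα' : 0 ≤ α' := (norm_nonneg _).trans h.diff_deriv₀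
  have h1 : ‖(fderiv ℝ (f t) y₁ - fderiv ℝ (f t) z₁) - (fderiv ℝ (f s) y₀ - fderiv ℝ (f s) z₀)‖ ≤
      3 * K ^ 3 * (α + α' + σ * x) * x := by
    have := hf.norm_four_point_fderiv_le hs ht hst y₀ y₁ z₀ z₁
    rw [← hx] at this
    exact this.trans (h.four_point_bound hσ)
  have h2 : ‖fderiv ℝ (f s) y₀ - fderiv ℝ (f s) z₀‖ ≤ K * α :=
    (hf.lipschitz_fderiv hs y₀ z₀).trans (mul_le_mul_of_nonneg_left h.diff₀ hK0)
  have h3 : ‖fderiv ℝ (f t) z₁ - fderiv ℝ (f s) z₀‖ ≤ K * (K * x) + K * (2 * K ^ 2 * x) := by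
    have a := hf.time_fderiv s hs t ht hst z₁
    have b := (hf.lipschitz_fderiv hs z₁ z₀).trans
      (mul_le_mul_of_nonneg_left h.right_increment hK0)
    rw [← hx] at a
    have a' : K * x ^ 2 ≤ K * (K * x) := by rw [pow_two]; gcongr
    rw [← sub_add_sub_cancel _ (fderiv ℝ (f s) z₁)]
    exact (norm_add_le _ _).trans (add_le_add (a.trans a') b)
  have c1 := ContinuousLinearMap.norm_comp_le_of_le h1 h.left_deriv₁
  have c2 := ContinuousLinearMap.norm_comp_le_of_le h2 h.left_deriv_sub
  have c3 := ContinuousLinearMap.norm_comp_le_of_le h3 h.diff_deriv₁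
  have c4 := ContinuousLinearMap.norm_comp_le_of_le (hf.norm_fderiv_le s hs z₀) h.diff_deriv_sub
  have e1 : K ≤ K ^ 5 := le_self_pow₀ hK (by norm_num)
  have e2 : K ^ 2 ≤ K ^ 5 := pow_le_pow_right₀ hK (by norm_num)
  have e3 : K ^ 3 ≤ K ^ 5 := pow_le_pow_right₀ hK (by norm_num)
  have e4 : K ^ 4 ≤ K ^ 5 := pow_le_pow_right₀ hK (by norm_num)
  have e5 : 0 ≤ K ^ 5 := by positivity
  calc _ = ‖((fderiv ℝ (f t) y₁ - fderiv ℝ (f t) z₁) -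
          (fderiv ℝ (f s) y₀ - fderiv ℝ (f s) z₀)).comp y₁' +
        (fderiv ℝ (f s) y₀ - fderiv ℝ (f s) z₀).comp (y₁' - y₀') +
        (fderiv ℝ (f t) z₁ - fderiv ℝ (f s) z₀).comp (y₁' - z₁') +
        (fderiv ℝ (f s) z₀).comp ((y₁' - z₁') - (y₀' - z₀'))‖ := by
        simp only [ContinuousLinearMap.sub_comp, ContinuousLinearMap.comp_sub]; congr 1; abel
    _ ≤ _ := norm_add₄_le_of_le c1 c2 c3 c4
    _ = (3 * K ^ 4 * (α + α') + 3 * K ^ 4 * (σ * x) + K ^ 2 * α + K ^ 2 * α' + 2 * K ^ 3 * α'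
          + K * ρ) * x := by ring
    _ ≤ (3 * K ^ 5 * (α + α') + 3 * K ^ 4 * (σ * K) + K ^ 5 * α + K ^ 5 * α' + 2 * K ^ 5 * α'
          + K ^ 5 * ρ) * x := by gcongr
    _ ≤ _ := by
      refine mul_le_mul_of_nonneg_right ?_ hx0
      nlinarith [mul_nonneg e5 hα, mul_nonneg e5 hα', mul_nonneg e5 hρ, mul_nonneg e5 hσ]

theorem norm_comp_remainder_sub_le
    (h : PairBound K x α α' ρ σ ΔX y₀ y₁ z₀ z₁ y₀' y₁' z₀' z₁')
    (hf : FieldBound β T K f) {s t : ℝ} (hs : s ∈ Icc 0 T) (ht : t ∈ Icc 0 T) (hst : s ≤ t)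
    (hx : x = (t - s) ^ β) (hσ : 0 ≤ σ) :
    ‖(f t y₁ - f t z₁) - (f s y₀ - f s z₀) -
        ((fderiv ℝ (f s) y₀).comp y₀' - (fderiv ℝ (f s) z₀).comp z₀') ΔX‖ ≤
      10 * K ^ 5 * (α + α' + σ) * x ^ 2 := by
  have hK := h.one_le
  have hK0 : 0 ≤ K := by linarith
  have hx0 := h.x_nonneg
  have hxK := h.x_le
  have hα : 0 ≤ α := (norm_nonneg _).trans h.diff₀
  have hα' : 0 ≤ α' := (norm_nonneg _).trans h.diff_deriv₀
  -- the change of `f` in time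
  have h1 : ‖(f t y₁ - f s y₁) - (f t z₁ - f s z₁)‖ ≤ K * x ^ 2 * α := by
    refine (norm_sub_le_of_hasFDerivAt (g := fun y => f t y - f s y)
      (g' := fun y => fderiv ℝ (f t) y - fderiv ℝ (f s) y)
      (fun y => (hf.hasFDerivAt t ht y).sub (hf.hasFDerivAt s hs y))
      (hf.time_fderiv s hs t ht hst) y₁ z₁).trans ?_
    rw [← hx]
    have := h.diff₁
    gcongr
  -- the Taylor remainders of `f s`
  have h2 := norm_taylor_sub_taylor_le hK0 (hf.hasFDerivAt s hs) (hf.hasFDerivAt_fderiv s hs)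
    (hf.norm_fderiv_fderiv_le s hs) (hf.fderiv_fderiv_sub_le s hs) y₀ z₀ (y₁ - y₀) (z₁ - z₀)
  rw [add_sub_cancel, add_sub_cancel] at h2
  have h2' : K * ‖y₁ - y₀‖ * ‖y₁ - y₀‖ * ‖y₀ - z₀‖ +
      K * (‖y₁ - y₀‖ + ‖z₁ - z₀‖) * ‖(y₁ - y₀) - (z₁ - z₀)‖ ≤
      K * (2 * K ^ 2 * x) * (2 * K ^ 2 * x) * α +
      K * (2 * K ^ 2 * x + 2 * K ^ 2 * x) * ((α' * K + σ * x) * x) := by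
    have a := h.left_increment
    have b := h.right_increment
    have c := h.diff_increment
    have d := h.diff₀
    rw [sub_sub_sub_comm] at c
    gcongr
  -- the remainders of the two paths
  have h3 : ‖(fderiv ℝ (f s) y₀ - fderiv ℝ (f s) z₀) (y₁ - y₀ - y₀' ΔX)‖ ≤
      K * α * (K * x ^ 2) := by
    have a : ‖fderiv ℝ (f s) y₀ - fderiv ℝ (f s) z₀‖ ≤ K * α :=
      (hf.lipschitz_fderiv hs y₀ z₀).trans (mul_le_mul_of_nonneg_left h.diff₀ hK0)
    exact (ContinuousLinearMap.le_opNorm _ _).trans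
      (mul_le_mul a h.left_remainder (norm_nonneg _) (by positivity))
  have h4 : ‖fderiv ℝ (f s) z₀ ((y₁ - z₁) - (y₀ - z₀) - (y₀' - z₀') ΔX)‖ ≤ K * (σ * x ^ 2) :=
    (ContinuousLinearMap.le_opNorm _ _).trans
      (mul_le_mul (hf.norm_fderiv_le s hs z₀) h.diff_remainder (norm_nonneg _) hK0)
  have e1 : K ≤ K ^ 5 := le_self_pow₀ hK (by norm_num)
  have e2 : K ^ 2 ≤ K ^ 5 := pow_le_pow_right₀ hK (by norm_num)
  have e4 : K ^ 4 ≤ K ^ 5 := pow_le_pow_right₀ hK (by norm_num)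
  have e3 : K ^ 3 * K ≤ K ^ 5 := by rw [← pow_succ]; exact e4
  have e5 : 0 ≤ K ^ 5 := by positivity
  calc _ = ‖((f t y₁ - f s y₁) - (f t z₁ - f s z₁)) +
        ((f s y₁ - f s y₀ - fderiv ℝ (f s) y₀ (y₁ - y₀)) -
          (f s z₁ - f s z₀ - fderiv ℝ (f s) z₀ (z₁ - z₀))) +
        (fderiv ℝ (f s) y₀ - fderiv ℝ (f s) z₀) (y₁ - y₀ - y₀' ΔX) +
        fderiv ℝ (f s) z₀ ((y₁ - z₁) - (y₀ - z₀) - (y₀' - z₀') ΔX)‖ := by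
        congr 1
        simp only [sub_apply, ContinuousLinearMap.comp_apply, map_sub]
        abel
    _ ≤ _ := norm_add₄_le_of_le h1 (h2.trans h2') h3 h4
    _ = (K * α + 4 * K ^ 5 * α + 4 * K ^ 4 * α' + 4 * K ^ 3 * (σ * x) + K ^ 2 * α + K * σ)
          * x ^ 2 := by ring
    _ ≤ (K ^ 5 * α + 4 * K ^ 5 * α + 4 * K ^ 5 * α' + 4 * K ^ 3 * (σ * K) + K ^ 5 * α + K ^ 5 * σ)
          * x ^ 2 := by gcongr
    _ ≤ _ := by
      refine mul_le_mul_of_nonneg_right ?_ (sq_nonneg x)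
      nlinarith [mul_nonneg e5 hα, mul_nonneg e5 hα', mul_nonneg e5 hσ,
        mul_le_mul_of_nonneg_right e3 hσ]

end PairBound

end Composition

/-! ### Rough integrals -/

section RoughIntegral

variable {V W : Type*} [NormedAddCommGroup V] [NormedSpace ℝ V]
  [NormedAddCommGroup W] [NormedSpace ℝ W] [CompleteSpace W]
  {β T Λ : ℝ} {X : ℝ → V} {XX : ℝ → ℝ → ProjTensor V}

/-- The summand `Z_s X_{s,t} + Z'_s 𝕏_{s,t}` of the compensated Riemann sums. -/
noncomputable def germ (X : ℝ → V) (XX : ℝ → ℝ → ProjTensor V) (Z : ℝ → V →L[ℝ] W)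
    (Z' : ℝ → V →L[ℝ] V →L[ℝ] W) (s t : ℝ) : W :=
  Z s (X t - X s) + tensorLift (Z' s) (XX s t)

theorem germ_sub (Z₁ Z₂ : ℝ → V →L[ℝ] W) (Z₁' Z₂' : ℝ → V →L[ℝ] V →L[ℝ] W) (s t : ℝ) :
    germ X XX (fun r => Z₁ r - Z₂ r) (fun r => Z₁' r - Z₂' r) s t =
      germ X XX Z₁ Z₁' s t - germ X XX Z₂ Z₂' s t := by
  simp only [germ, tensorLift_sub, sub_apply]
  abel

/-- The defect of the germ, by Chen's relation. -/
theorem germ_defect {s u t : ℝ} (h : XX s t - XX s u - XX u t = elemTensor (X u - X s) (X t - X u))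
    (Z : ℝ → V →L[ℝ] W) (Z' : ℝ → V →L[ℝ] V →L[ℝ] W) :
    germ X XX Z Z' s t - germ X XX Z Z' s u - germ X XX Z Z' u t =
      -((Z u - Z s - Z' s (X u - X s)) (X t - X u) + tensorLift (Z' u - Z' s) (XX u t)) := by
  have h' : XX s t = XX s u + XX u t + elemTensor (X u - X s) (X t - X u) := by
    rw [← h]; abel
  have e : X t - X s = (X t - X u) + (X u - X s) := by abel
  simp only [germ, tensorLift_sub, sub_apply, h', map_add, tensorLift_elemTensor]
  rw [e, map_add]
  abel

theorem RoughBound.norm_germ_defect_le (hX : RoughBound β T Λ X XX) (hβ : 0 ≤ β) (hΛ : 0 ≤ Λ)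
    {Z : ℝ → V →L[ℝ] W} {Z' : ℝ → V →L[ℝ] V →L[ℝ] W} {s u t C : ℝ} (hs : 0 ≤ s) (hsu : s ≤ u)
    (hut : u ≤ t) (ht : t ≤ T) (hC : 0 ≤ C)
    (hZ : ‖Z u - Z s - Z' s (X u - X s)‖ ≤ C * ((u - s) ^ β) ^ 2)
    (hZ' : ‖Z' u - Z' s‖ ≤ C * (u - s) ^ β) :
    ‖germ X XX Z Z' s t - germ X XX Z Z' s u - germ X XX Z Z' u t‖ ≤
      2 * Λ * C * (t - s) ^ (3 * β) := by
  have h0 : 0 ≤ t - s := by linarith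
  have hx : (u - s) ^ β ≤ (t - s) ^ β := Real.rpow_le_rpow (by linarith) (by linarith) hβ
  have hy : (t - u) ^ β ≤ (t - s) ^ β := Real.rpow_le_rpow (by linarith) (by linarith) hβ
  have hx0 : 0 ≤ (u - s) ^ β := Real.rpow_nonneg (by linarith) _
  have hy0 : 0 ≤ (t - u) ^ β := Real.rpow_nonneg (by linarith) _
  rw [germ_defect (hX.chen s u t hs hsu hut ht), norm_neg, rpow_mul_three_of_nonneg h0]
  set x := (t - s) ^ β
  have hxx : 0 ≤ x := hx0.trans hx
  have h1 : ‖(Z u - Z s - Z' s (X u - X s)) (X t - X u)‖ ≤ C * x ^ 2 * (Λ * x) := by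
    refine (ContinuousLinearMap.le_opNorm _ _).trans (mul_le_mul (hZ.trans (by gcongr))
      ((hX.path u t (by linarith) hut ht).trans (by gcongr)) (norm_nonneg _) (by positivity))
  have h2 : ‖tensorLift (Z' u - Z' s) (XX u t)‖ ≤ C * x * (Λ * x ^ 2) := by
    refine (norm_tensorLift_apply_le _ _).trans (mul_le_mul (hZ'.trans (by gcongr))
      ((hX.area u t (by linarith) hut ht).trans (by gcongr)) (norm_nonneg _) (by positivity))
  calc _ ≤ _ := (norm_add_le _ _).trans (add_le_add h1 h2)
    _ = _ := by ring

/-- A two-parameter map of order `3β` with the same defect as a germ, up to sign, is bounded by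
the controlled norm of the integrand. -/
theorem RoughBound.norm_le_of_germ (hX : RoughBound β T Λ X XX) (hβ : 1 / 3 < β) (hΛ : 0 ≤ Λ)
    {Z : ℝ → V →L[ℝ] W} {Z' : ℝ → V →L[ℝ] V →L[ℝ] W} {J : ℝ → ℝ → W} {m : ℝ}
    (hJ : ∀ s u t, 0 ≤ s → s ≤ u → u ≤ t → t ≤ T → J s t - J s u - J u t =
      -(germ X XX Z Z' s t - germ X XX Z Z' s u - germ X XX Z Z' u t))
    (hm : ∀ s t, 0 ≤ s → s ≤ t → t ≤ T → ‖J s t‖ ≤ m * ((t - s) ^ β) ^ 3)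
    {a b C : ℝ} (ha : 0 ≤ a) (hab : a ≤ b) (hb : b ≤ T) (hC : 0 ≤ C)
    (hZ : ∀ s t, a ≤ s → s ≤ t → t ≤ b →
      ‖Z t - Z s - Z' s (X t - X s)‖ ≤ C * ((t - s) ^ β) ^ 2)
    (hZ' : ∀ s t, a ≤ s → s ≤ t → t ≤ b → ‖Z' t - Z' s‖ ≤ C * (t - s) ^ β) :
    ‖J a b‖ ≤ sewingConst (3 * β) * (2 * Λ * C) * ((b - a) ^ β) ^ 3 := by
  rw [← rpow_mul_three_of_nonneg (sub_nonneg.2 hab)]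
  refine norm_le_of_defect (m := m) (by linarith) (fun s t hs hst ht => ?_)
    (fun s u t hs hsu hut ht => ?_) hab (by positivity)
  · rw [rpow_mul_three_of_nonneg (sub_nonneg.2 hst)]
    exact hm s t (ha.trans hs) hst (ht.trans hb)
  · rw [hJ s u t (ha.trans hs) hsu hut (ht.trans hb), norm_neg]
    exact hX.norm_germ_defect_le (by linarith) hΛ (ha.trans hs) hsu hut (ht.trans hb) hC
      (hZ s u hs hsu (hut.trans ht)) (hZ' s u hs hsu (hut.trans ht))

theorem RoughBound.exists_integral (hX : RoughBound β T Λ X XX) (hβ : 1 / 3 < β) (hΛ : 0 ≤ Λ)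
    (hT : 0 ≤ T) {Z : ℝ → V →L[ℝ] W} {Z' : ℝ → V →L[ℝ] V →L[ℝ] W} {C : ℝ} (hC : 0 ≤ C)
    (hZ : ∀ s t, 0 ≤ s → s ≤ t → t ≤ T →
      ‖Z t - Z s - Z' s (X t - X s)‖ ≤ C * ((t - s) ^ β) ^ 2)
    (hZ' : ∀ s t, 0 ≤ s → s ≤ t → t ≤ T → ‖Z' t - Z' s‖ ≤ C * (t - s) ^ β) :
    ∃ I : ℝ → W, ∃ m, 0 ≤ m ∧ ∀ s t, 0 ≤ s → s ≤ t → t ≤ T →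
      ‖I t - I s - germ X XX Z Z' s t‖ ≤ m * (t - s) ^ (3 * β) :=
  exists_sewing (by linarith) (by positivity : 0 ≤ 2 * Λ * C) hT fun s u t hs hsu hut ht =>
    hX.norm_germ_defect_le (by linarith) hΛ hs hsu hut ht hC
      (hZ s u hs hsu (hut.trans ht)) (hZ' s u hs hsu (hut.trans ht))

/-- A path whose increments agree with the germ up to order `θ > 1` is the rough integral. -/
theorem hasRoughIntegral_of_expansion {Z : ℝ → V →L[ℝ] W} {Z' : ℝ → V →L[ℝ] V →L[ℝ] W}
    {I : ℝ → W} {θ m b : ℝ} (hθ : 1 < θ) (hm : 0 ≤ m) (hb : 0 ≤ b)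
    (hI : ∀ s t, 0 ≤ s → s ≤ t → t ≤ b → ‖I t - I s - germ X XX Z Z' s t‖ ≤ m * (t - s) ^ θ) :
    HasRoughIntegral X XX Z Z' 0 b (I b - I 0) := by
  intro ε hε
  have hc : 0 < m * b + 1 := by positivity
  refine ⟨(ε / (m * b + 1)) ^ (θ - 1)⁻¹, by positivity, fun n τ h0 hn hτ => ?_⟩
  set δ := (ε / (m * b + 1)) ^ (θ - 1)⁻¹ with hδ
  have hδθ : δ ^ (θ - 1) = ε / (m * b + 1) := by
    rw [hδ, ← Real.rpow_mul (by positivity), inv_mul_cancel₀ (by linarith), Real.rpow_one]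
  have hmono : ∀ i j, i ≤ j → j ≤ n → τ i ≤ τ j := by
    intro i j hij
    induction j, hij using Nat.le_induction with
    | base => exact fun _ => le_rfl
    | succ j hij ih => exact fun hj => (ih (by omega)).trans (hτ j (by omega)).1.le
  have hsum : I b - I 0 = ∑ i ∈ Finset.range n, (I (τ (i + 1)) - I (τ i)) := by
    rw [Finset.sum_range_sub (fun i => I (τ i)), h0, hn]
  have hlen : ∑ i ∈ Finset.range n, (τ (i + 1) - τ i) = b := by
    rw [Finset.sum_range_sub, h0, hn, sub_zero]
  rw [hsum, ← Finset.sum_sub_distrib]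
  calc _ ≤ ∑ i ∈ Finset.range n, m * (ε / (m * b + 1)) * (τ (i + 1) - τ i) := by
        refine norm_sum_le_of_le _ fun i hi => ?_
        have hin : i < n := Finset.mem_range.1 hi
        obtain ⟨h1, h2⟩ := hτ i hin
        have hd : 0 < τ (i + 1) - τ i := sub_pos.2 h1
        rw [norm_sub_rev]
        refine (hI (τ i) (τ (i + 1)) (h0 ▸ hmono 0 i (by omega) hin.le) h1.le
          (hn ▸ hmono (i + 1) n hin le_rfl)).trans ?_
        have e : (τ (i + 1) - τ i) ^ θ = (τ (i + 1) - τ i) ^ (θ - 1) * (τ (i + 1) - τ i) := by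
          rw [← Real.rpow_add_one hd.ne']; simp
        rw [e, ← hδθ, mul_assoc]
        gcongr
    _ = m * b * ε / (m * b + 1) := by rw [← Finset.mul_sum, hlen]; ring
    _ < ε := by
      rw [div_lt_iff₀ hc]
      linarith

theorem HasRoughIntegral.unique {Z : ℝ → V →L[ℝ] W} {Z' : ℝ → V →L[ℝ] V →L[ℝ] W} {b : ℝ}
    (hb : 0 ≤ b) {I₁ I₂ : W} (h₁ : HasRoughIntegral X XX Z Z' 0 b I₁)
    (h₂ : HasRoughIntegral X XX Z Z' 0 b I₂) : I₁ = I₂ := by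
  refine eq_of_forall_dist_le fun ε hε => ?_
  obtain ⟨δ₁, hδ₁, h₁⟩ := h₁ (ε / 2) (by positivity)
  obtain ⟨δ₂, hδ₂, h₂⟩ := h₂ (ε / 2) (by positivity)
  -- a partition whose mesh is less than both `δ₁` and `δ₂`
  obtain ⟨n, τ, h0, hn, hτ⟩ : ∃ (n : ℕ) (τ : ℕ → ℝ), τ 0 = 0 ∧ τ n = b ∧
      ∀ i < n, τ i < τ (i + 1) ∧ τ (i + 1) - τ i < min δ₁ δ₂ := by
    rcases hb.eq_or_lt with rfl | hb
    · exact ⟨0, fun _ => 0, rfl, rfl, by simp⟩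
    · obtain ⟨n, hn⟩ := exists_nat_gt (b / min δ₁ δ₂)
      have hδ : 0 < min δ₁ δ₂ := lt_min hδ₁ hδ₂
      have hn0 : 0 < (n : ℝ) := (by positivity : 0 < b / min δ₁ δ₂).trans hn
      have e : ∀ i : ℕ, ((i + 1 : ℕ) : ℝ) * (b / n) - i * (b / n) = b / n := fun i => by
        push_cast; ring
      refine ⟨n, fun i => i * (b / n), by simp, by field_simp, fun i _ => ⟨?_, ?_⟩⟩
      · rw [← sub_pos, e]; positivity
      · rw [e, div_lt_iff₀ hn0]
        rwa [div_lt_iff₀ hδ, mul_comm] at hn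
  have a := h₁ n τ h0 hn fun i hi => ⟨(hτ i hi).1, (hτ i hi).2.trans_le (min_le_left _ _)⟩
  have b := h₂ n τ h0 hn fun i hi => ⟨(hτ i hi).1, (hτ i hi).2.trans_le (min_le_right _ _)⟩
  rw [← dist_eq_norm] at a b
  rw [dist_comm] at a
  linarith [dist_triangle I₁ (∑ i ∈ Finset.range n, (Z (τ i) (X (τ (i + 1)) - X (τ i))
        + tensorLift (Z' (τ i)) (XX (τ i) (τ (i + 1))))) I₂]

end RoughIntegral

/-! ### Picard steps -/

section Picard

variable {V W : Type*} [NormedAddCommGroup V] [NormedSpace ℝ V]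
  [NormedAddCommGroup W] [NormedSpace ℝ W]
  {β T Λ K : ℝ} {X : ℝ → V} {XX : ℝ → ℝ → ProjTensor V} {f₀ : ℝ → W → W}
  {f : ℝ → W → V →L[ℝ] W} {ξ : W} {Y : ℝ → W} {Y' : ℝ → V →L[ℝ] W}

/-- A controlled path all of whose norms are at most `K`. -/
structure ControlledBound (β T K : ℝ) (X : ℝ → V) (Y : ℝ → W) (Y' : ℝ → V →L[ℝ] W) : Prop where
  value : ∀ t ∈ Icc 0 T, ‖Y t‖ ≤ K
  deriv : ∀ t ∈ Icc 0 T, ‖Y' t‖ ≤ K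
  deriv_holder : ∀ s t, 0 ≤ s → s ≤ t → t ≤ T → ‖Y' t - Y' s‖ ≤ K * (t - s) ^ β
  remainder : ∀ s t, 0 ≤ s → s ≤ t → t ≤ T →
    ‖Y t - Y s - Y' s (X t - X s)‖ ≤ K * ((t - s) ^ β) ^ 2

theorem ControlledBound.mono (h : ControlledBound β T K X Y Y') {K' : ℝ} (hK : K ≤ K') :
    ControlledBound β T K' X Y Y' where
  value t ht := (h.value t ht).trans hK
  deriv t ht := (h.deriv t ht).trans hK
  deriv_holder s t hs hst ht := (h.deriv_holder s t hs hst ht).trans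
    (mul_le_mul_of_nonneg_right hK (Real.rpow_nonneg (sub_nonneg.2 hst) _))
  remainder s t hs hst ht := (h.remainder s t hs hst ht).trans
    (mul_le_mul_of_nonneg_right hK (sq_nonneg _))

theorem ControlledBound.path (h : ControlledBound β T K X Y Y')
    (hD : RodeBound β T Λ X XX f₀ f) {s t : ℝ} (hs : 0 ≤ s) (hst : s ≤ t) (ht : t ≤ T) :
    ‖Y t - Y s‖ ≤ (K * Λ + K * Λ) * (t - s) ^ β := by
  have hK : 0 ≤ K := (norm_nonneg _).trans (h.value s ⟨hs, hst.trans ht⟩)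
  refine (norm_increment_le_of_remainder (hD.rough.path s t hs hst ht)
    (h.deriv s ⟨hs, hst.trans ht⟩) (h.remainder s t hs hst ht)).trans ?_
  have := Real.rpow_nonneg (sub_nonneg.2 hst) β
  have := hD.rpow_le s t hs hst ht
  gcongr

theorem continuousOn_of_norm_sub_le_rpow {E : Type*} [NormedAddCommGroup E] {β T C : ℝ}
    (hβ : 0 < β) {Y : ℝ → E}
    (h : ∀ s t, 0 ≤ s → s ≤ t → t ≤ T → ‖Y t - Y s‖ ≤ C * (t - s) ^ β) :
    ContinuousOn Y (Icc 0 T) := by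
  have habs : ∀ s ∈ Icc 0 T, ∀ t ∈ Icc 0 T, ‖Y t - Y s‖ ≤ C * |t - s| ^ β := by
    intro s hs t ht
    rcases le_total s t with hst | hst
    · rw [abs_of_nonneg (sub_nonneg.2 hst)]
      exact h s t hs.1 hst ht.2
    · rw [abs_sub_comm, abs_of_nonneg (sub_nonneg.2 hst), norm_sub_rev]
      exact h t s ht.1 hst hs.2
  intro s hs
  refine tendsto_iff_norm_sub_tendsto_zero.2 (squeeze_zero' (g := fun t => C * |t - s| ^ β)
    (Filter.Eventually.of_forall fun t => norm_nonneg _)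
    (Filter.eventually_of_mem self_mem_nhdsWithin fun t ht => habs s hs t ht) ?_)
  have hc : Continuous fun t : ℝ => C * |t - s| ^ β :=
    continuous_const.mul ((continuous_abs.comp (continuous_id.sub continuous_const)).rpow_const
      fun _ => Or.inr hβ.le)
  have := (hc.tendsto s).mono_left (nhdsWithin_le_nhds (s := Icc 0 T))
  simpa [Real.zero_rpow hβ.ne'] using this

theorem DriftBound.intervalIntegrable {W : Type*} [NormedAddCommGroup W]
    {f₀ : ℝ → W → W} {Y : ℝ → W} (hf₀ : DriftBound T Λ f₀) (hY : ContinuousOn Y (Icc 0 T))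
    {a b : ℝ} (ha : a ∈ Icc 0 T) (hb : b ∈ Icc 0 T) :
    IntervalIntegrable (fun r => f₀ r (Y r)) volume a b := by
  refine ContinuousOn.intervalIntegrable (ContinuousOn.mono ?_ (uIcc_subset_Icc ha hb))
  exact hf₀.continuousOn.comp (f := fun r => (r, Y r)) (continuousOn_id.prodMk hY)
    fun r hr => ⟨hr, mem_univ _⟩

theorem ControlledBound.intervalIntegrable (h : ControlledBound β T K X Y Y')
    (hD : RodeBound β T Λ X XX f₀ f) (hβ : 0 < β) {a b : ℝ} (ha : a ∈ Icc 0 T)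
    (hb : b ∈ Icc 0 T) : IntervalIntegrable (fun r => f₀ r (Y r)) volume a b :=
  hD.drift.intervalIntegrable (continuousOn_of_norm_sub_le_rpow hβ fun _ _ => h.path hD) ha hb

/-- The composition of a controlled path with the vector field is controlled. -/
theorem exists_controlledBound_comp (hD : RodeBound β T Λ X XX f₀ f) (hK : 0 ≤ K) :
    ∃ C, 0 ≤ C ∧ ∀ {Y : ℝ → W} {Y' : ℝ → V →L[ℝ] W}, ControlledBound β T K X Y Y' →
    (∀ s t, 0 ≤ s → s ≤ t → t ≤ T → ‖f t (Y t) - f s (Y s) -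
      ((fderiv ℝ (f s) (Y s)).comp (Y' s)) (X t - X s)‖ ≤ C * ((t - s) ^ β) ^ 2) ∧
    (∀ s t, 0 ≤ s → s ≤ t → t ≤ T → ‖(fderiv ℝ (f t) (Y t)).comp (Y' t) -
      (fderiv ℝ (f s) (Y s)).comp (Y' s)‖ ≤ C * (t - s) ^ β) := by
  have hΛ : 0 ≤ Λ := by linarith [hD.one_le]
  refine ⟨max (Λ * (1 + K + (K * Λ) ^ 2)) (Λ * (Λ + (K * Λ + K * Λ)) * K + Λ * K),
    le_max_of_le_left (by positivity),
    fun h => ⟨fun s t hs hst ht => ?_, fun s t hs hst ht => ?_⟩⟩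
  · refine (hD.field.norm_comp_remainder_le hΛ ⟨hs, hst.trans ht⟩ ⟨hs.trans hst, ht⟩ hst rfl
      (hD.rough.path s t hs hst ht) (h.deriv s ⟨hs, hst.trans ht⟩)
      (h.remainder s t hs hst ht)).trans ?_
    gcongr
    exact le_max_left _ _
  · refine (hD.field.norm_comp_deriv_le hΛ ⟨hs, hst.trans ht⟩ ⟨hs.trans hst, ht⟩ hst rfl
      (h.deriv t ⟨hs.trans hst, ht⟩) (h.deriv_holder s t hs hst ht) (h.path hD hs hst ht)).trans ?_
    have := Real.rpow_nonneg (sub_nonneg.2 hst) β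
    have := hD.rpow_le s t hs hst ht
    gcongr
    refine le_trans ?_ (le_max_right _ _)
    gcongr

variable [CompleteSpace W]

/-- The error of the one-step expansion of `Y₁` on `[s, t]`, when `Y₁` is the Picard image of the
controlled path `(Y, Y')`. -/
noncomputable def picardError (X : ℝ → V) (XX : ℝ → ℝ → ProjTensor V) (f₀ : ℝ → W → W)
    (f : ℝ → W → V →L[ℝ] W) (Y : ℝ → W) (Y' : ℝ → V →L[ℝ] W) (Y₁ : ℝ → W) (s t : ℝ) : W :=
  Y₁ t - Y₁ s - (∫ r in s..t, f₀ r (Y r)) -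
    germ X XX (fun r => f r (Y r)) (fun r => (fderiv ℝ (f r) (Y r)).comp (Y' r)) s t

/-- `(Y₁, Y₁')` is the image of `(Y, Y')` under the Picard map
`Y₁ = ξ + ∫ f₀(Y) dt + ∫ f(Y) d𝐗`, `Y₁' = f(Y)`. The rough integral is expressed by its one-step
expansion, which makes the relation stable under limits. -/
structure IsPicardStep (β T : ℝ) (X : ℝ → V) (XX : ℝ → ℝ → ProjTensor V) (f₀ : ℝ → W → W)
    (f : ℝ → W → V →L[ℝ] W) (ξ : W) (Y : ℝ → W) (Y' : ℝ → V →L[ℝ] W) (Y₁ : ℝ → W)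
    (Y₁' : ℝ → V →L[ℝ] W) : Prop where
  init : Y₁ 0 = ξ
  deriv : ∀ t ∈ Icc 0 T, Y₁' t = f t (Y t)
  expansion : ∃ m, ∀ s t, 0 ≤ s → s ≤ t → t ≤ T →
    ‖picardError X XX f₀ f Y Y' Y₁ s t‖ ≤ m * ((t - s) ^ β) ^ 3

theorem ControlledBound.exists_isPicardStep (h : ControlledBound β T K X Y Y')
    (hD : RodeBound β T Λ X XX f₀ f) (hβ : 1 / 3 < β) (hT : 0 ≤ T) (ξ : W) :
    ∃ Y₁, IsPicardStep β T X XX f₀ f ξ Y Y' Y₁ (fun t => f t (Y t)) := by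
  obtain ⟨C, hC, hcomp⟩ := exists_controlledBound_comp hD
    ((norm_nonneg _).trans (h.value 0 ⟨le_rfl, hT⟩))
  obtain ⟨h1, h2⟩ := hcomp h
  obtain ⟨I, m, _, hI⟩ := hD.rough.exists_integral hβ (by linarith [hD.one_le]) hT
    (Z := fun r => f r (Y r)) (Z' := fun r => (fderiv ℝ (f r) (Y r)).comp (Y' r)) hC h1 h2
  refine ⟨fun t => ξ + (∫ r in (0 : ℝ)..t, f₀ r (Y r)) + (I t - I 0), by simp, fun _ _ => rfl, m,
    fun s t hs hst ht => ?_⟩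
  rw [← rpow_mul_three_of_nonneg (sub_nonneg.2 hst)]
  refine le_trans (le_of_eq ?_) (hI s t hs hst ht)
  have h0 : (0 : ℝ) ∈ Icc 0 T := ⟨le_rfl, hT⟩
  have hs' : s ∈ Icc 0 T := ⟨hs, hst.trans ht⟩
  have ht' : t ∈ Icc 0 T := ⟨hs.trans hst, ht⟩
  have e := intervalIntegral.integral_add_adjacent_intervals
    (h.intervalIntegrable hD (by linarith) h0 hs') (h.intervalIntegrable hD (by linarith) hs' ht')
  rw [picardError, ← e]
  congr 1
  abel

/-- The defect of the expansion error is that of the germ: the other terms are additive. -/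
theorem ControlledBound.picardError_defect (h : ControlledBound β T K X Y Y')
    (hD : RodeBound β T Λ X XX f₀ f) (hβ : 0 < β) (Y₁ : ℝ → W) {s u t : ℝ} (hs : 0 ≤ s)
    (hsu : s ≤ u) (hut : u ≤ t) (ht : t ≤ T) :
    picardError X XX f₀ f Y Y' Y₁ s t - picardError X XX f₀ f Y Y' Y₁ s u -
        picardError X XX f₀ f Y Y' Y₁ u t =
      -(germ X XX (fun r => f r (Y r)) (fun r => (fderiv ℝ (f r) (Y r)).comp (Y' r)) s t -
        germ X XX (fun r => f r (Y r)) (fun r => (fderiv ℝ (f r) (Y r)).comp (Y' r)) s u -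
        germ X XX (fun r => f r (Y r)) (fun r => (fderiv ℝ (f r) (Y r)).comp (Y' r)) u t) := by
  have hs' : s ∈ Icc 0 T := ⟨hs, by linarith⟩
  have hu' : u ∈ Icc 0 T := ⟨by linarith, by linarith⟩
  have ht' : t ∈ Icc 0 T := ⟨by linarith, ht⟩
  have e := intervalIntegral.integral_add_adjacent_intervals
    (h.intervalIntegrable hD hβ hs' hu') (h.intervalIntegrable hD hβ hu' ht')
  rw [picardError, picardError, picardError, ← e]
  abel

end Picard

/-! ### Weighted norms -/

section Weighted

variable {V W : Type*} [NormedAddCommGroup V] [NormedSpace ℝ V]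
  [NormedAddCommGroup W] [NormedSpace ℝ W]
  {β T Λ K : ℝ} {X : ℝ → V} {XX : ℝ → ℝ → ProjTensor V} {f₀ : ℝ → W → W}
  {f : ℝ → W → V →L[ℝ] W} {ξ : W}

/-- The controlled norm of `(A, A')` is at most `B`, when it is measured on windows of length `h`
with the exponential weight `exp (t / h)`, and when its components are scaled by powers of `ε`.
The powers are chosen such that each component of the image under a Picard step is estimated by
the components of the argument with a gain of a factor `ε`, provided that `h ^ β = ε ^ 3`. -/
structure WeightedBound (β T : ℝ) (X : ℝ → V) (h ε B : ℝ) (A : ℝ → W) (A' : ℝ → V →L[ℝ] W) :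
    Prop where
  value : ∀ t ∈ Icc 0 T, ‖A t‖ ≤ ε ^ 3 * (B * Real.exp (t / h))
  deriv : ∀ t ∈ Icc 0 T, ‖A' t‖ ≤ ε ^ 2 * (B * Real.exp (t / h))
  deriv_holder : ∀ s t, 0 ≤ s → s ≤ t → t ≤ T → t - s ≤ h →
    ‖A' t - A' s‖ ≤ ε * (B * Real.exp (t / h)) * (t - s) ^ β
  remainder : ∀ s t, 0 ≤ s → s ≤ t → t ≤ T → t - s ≤ h →
    ‖A t - A s - A' s (X t - X s)‖ ≤ B * Real.exp (t / h) * ((t - s) ^ β) ^ 2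

/-- Increments over windows of length `h` control the path: the weight turns the sum over the
windows into a geometric series of ratio `exp (-1) ≤ 1 / 2`. -/
theorem norm_le_of_window_increments {E : Type*} [NormedAddCommGroup E] {A : ℝ → E} {h D : ℝ}
    (hh : 0 < h) (hD : 0 ≤ D)
    (hA : ∀ s t, 0 ≤ s → s ≤ t → t ≤ T → t - s ≤ h → ‖A t - A s‖ ≤ D * Real.exp (t / h))
    {t : ℝ} (ht : t ∈ Icc 0 T) : ‖A t‖ ≤ ‖A 0‖ + 2 * D * Real.exp (t / h) := by
  have main : ∀ n : ℕ, ∀ t ∈ Icc 0 T, t ≤ n * h → ‖A t‖ ≤ ‖A 0‖ + 2 * D * Real.exp (t / h) := by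
    intro n
    induction n with
    | zero =>
      intro t ht htn
      have : t = 0 := le_antisymm (by simpa using htn) ht.1
      subst this
      have : 0 ≤ 2 * D * Real.exp (0 / h) := by positivity
      linarith
    | succ n ih =>
      intro t ht htn
      have hexp := Real.exp_pos (t / h)
      rcases le_total t h with hth | hth
      · have h1 := hA 0 t le_rfl ht.1 ht.2 (by linarith)
        have h2 := norm_le_norm_add_norm_sub' (A t) (A 0)
        nlinarith
      · have h1 := hA (t - h) t (by linarith) (by linarith) ht.2 (by linarith)
        have h2 := ih (t - h) ⟨by linarith, by linarith [ht.2]⟩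
          (by push_cast at htn; linarith)
        have h3 := norm_le_norm_add_norm_sub' (A t) (A (t - h))
        have h4 : 2 * Real.exp ((t - h) / h) ≤ Real.exp (t / h) := by
          have e : t / h = 1 + (t - h) / h := by field_simp; ring
          rw [e, Real.exp_add]
          have := Real.add_one_le_exp (1 : ℝ)
          gcongr
          linarith
        nlinarith
  obtain ⟨n, hn⟩ := exists_nat_ge (t / h)
  exact main n t ht (by rwa [div_le_iff₀ hh] at hn)

variable [CompleteSpace W]

theorem one_le_sewingConst {θ : ℝ} (hθ : 1 < θ) : 1 ≤ sewingConst θ := by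
  have := sewingConst_mul hθ
  have := mul_pos (sewingConst_pos hθ) (Real.rpow_pos_of_pos two_pos (1 - θ))
  linarith

/-- The scales at which Picard steps with data bounded by `K` are contracting. -/
structure IsScale (β K h ε : ℝ) : Prop where
  h_pos : 0 < h
  ε_pos : 0 < ε
  rpow_eq : h ^ β = ε ^ 3
  small : 150 * (sewingConst (3 * β) * K ^ 6) * ε ≤ 1

theorem exists_isScale (hβ : 1 / 3 < β) (hK : 1 ≤ K) : ∃ h ε, IsScale β K h ε := by
  have hκ := sewingConst_pos (θ := 3 * β) (by linarith)
  have hβ0 : β ≠ 0 := by linarith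
  refine ⟨((1 / (150 * (sewingConst (3 * β) * K ^ 6))) ^ 3) ^ β⁻¹,
    1 / (150 * (sewingConst (3 * β) * K ^ 6)), by positivity, by positivity, ?_, ?_⟩
  · rw [← Real.rpow_mul (by positivity), inv_mul_cancel₀ hβ0, Real.rpow_one]
  · exact (mul_one_div_cancel (by positivity)).le

theorem pow_le_sewingConst_mul_pow (hβ : 1 / 3 < β) (hK : 1 ≤ K) {k : ℕ} (hk : k ≤ 6) :
    K ^ k ≤ sewingConst (3 * β) * K ^ 6 :=
  (pow_le_pow_right₀ hK hk).trans
    (le_mul_of_one_le_left (by positivity) (one_le_sewingConst (by linarith)))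

namespace IsScale

variable {h ε : ℝ}

theorem ε_le (H : IsScale β K h ε) (hβ : 1 / 3 < β) (hK : 1 ≤ K) : ε ≤ 1 / 150 := by
  have h1 : 1 ≤ sewingConst (3 * β) * K ^ 6 := by
    simpa using pow_le_sewingConst_mul_pow hβ hK (k := 0) (by norm_num)
  nlinarith [H.small, H.ε_pos]

theorem ε_sq_le (H : IsScale β K h ε) (hβ : 1 / 3 < β) (hK : 1 ≤ K) : ε ^ 2 ≤ ε := by
  nlinarith [H.ε_le hβ hK, H.ε_pos]

theorem ε_cube_le (H : IsScale β K h ε) (hβ : 1 / 3 < β) (hK : 1 ≤ K) : ε ^ 3 ≤ ε ^ 2 := by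
  nlinarith [H.ε_le hβ hK, H.ε_pos, sq_nonneg ε]

theorem rpow_le (H : IsScale β K h ε) (hβ : 1 / 3 < β) {s t : ℝ} (hst : s ≤ t) (hsth : t - s ≤ h) :
    (t - s) ^ β ≤ ε ^ 3 :=
  H.rpow_eq ▸ Real.rpow_le_rpow (sub_nonneg.2 hst) hsth (by linarith)

theorem weight_mono (H : IsScale β K h ε) {B : ℝ} (hB : 0 ≤ B) {s t : ℝ} (hst : s ≤ t) :
    B * Real.exp (s / h) ≤ B * Real.exp (t / h) := by
  have := H.h_pos
  gcongr

theorem le_weight (H : IsScale β K h ε) {B : ℝ} (hB : 0 ≤ B) {t : ℝ} (ht : 0 ≤ t) :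
    B ≤ B * Real.exp (t / h) :=
  le_mul_of_one_le_right hB (Real.one_le_exp (div_nonneg ht H.h_pos.le))

end IsScale

/-- The expansion error of a Picard step on a window is linear in the weighted norm. -/
theorem IsPicardStep.norm_picardError_le (hD : RodeBound β T Λ X XX f₀ f) (hβ : 1 / 3 < β)
    {h ε B : ℝ} (H : IsScale β Λ h ε) (hB0 : 0 ≤ B)
    {Y Y₁ : ℝ → W} {Y' Y₁' : ℝ → V →L[ℝ] W} (hK : ControlledBound β T K X Y Y')
    (hY : WeightedBound β T X h ε B Y Y') (hY' : ∀ t ∈ Icc 0 T, ‖Y' t‖ ≤ Λ)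
    (hstep : IsPicardStep β T X XX f₀ f ξ Y Y' Y₁ Y₁') {s t : ℝ} (hs : 0 ≤ s) (hst : s ≤ t)
    (ht : t ≤ T) (hsth : t - s ≤ h) :
    ‖picardError X XX f₀ f Y Y' Y₁ s t‖ ≤
      6 * (sewingConst (3 * β) * Λ ^ 6) * (1 + B * Real.exp (t / h)) * ((t - s) ^ β) ^ 3 := by
  have hΛ1 := hD.one_le
  have hΛ0 : 0 ≤ Λ := by linarith
  have hε := H.ε_pos
  have hε1 := H.ε_le hβ hΛ1
  have hε2 := H.ε_sq_le hβ hΛ1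
  have hε3 := H.ε_cube_le hβ hΛ1
  obtain ⟨m, hm⟩ := hstep.expansion
  have hb0 : 0 ≤ B * Real.exp (t / h) := by positivity
  have hbmono := fun c (hc : c ≤ t) => H.weight_mono hB0 hc
  have e1 : Λ ≤ Λ ^ 5 := le_self_pow₀ hΛ1 (by norm_num)
  have e2 : Λ ^ 2 ≤ Λ ^ 5 := pow_le_pow_right₀ hΛ1 (by norm_num)
  have e4 : Λ ^ 4 ≤ Λ ^ 5 := pow_le_pow_right₀ hΛ1 (by norm_num)
  have e5 : 0 ≤ Λ ^ 5 := by positivity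
  generalize B * Real.exp (t / h) = b at hb0 hbmono
  refine (hD.rough.norm_le_of_germ hβ hΛ0
    (fun s u t hs hsu hut ht => hK.picardError_defect hD (by linarith) Y₁ hs hsu hut ht) hm
    hs hst ht (C := 3 * Λ ^ 5 * (1 + b)) (by positivity) (fun a c ha hac hc => ?_)
    (fun a c ha hac hc => ?_)).trans (le_of_eq (by ring))
  · have ha0 := hs.trans ha
    have hcT := hc.trans ht
    have hwin : c - a ≤ h := by linarith
    refine (hD.field.norm_comp_remainder_le hΛ0 ⟨ha0, hac.trans hcT⟩ ⟨ha0.trans hac, hcT⟩ hac rfl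
      (hD.rough.path a c ha0 hac hcT) (hY' a ⟨ha0, hac.trans hcT⟩)
      ((hY.remainder a c ha0 hac hcT hwin).trans
        (mul_le_mul_of_nonneg_right (hbmono c hc) (sq_nonneg _)))).trans
      (mul_le_mul_of_nonneg_right ?_ (sq_nonneg _))
    calc Λ * (1 + b + (Λ * Λ) ^ 2) = Λ + Λ * b + Λ ^ 5 := by ring
      _ ≤ Λ ^ 5 + Λ ^ 5 * b + Λ ^ 5 := by gcongr
      _ ≤ _ := by nlinarith [mul_nonneg e5 hb0]
  · have ha0 := hs.trans ha
    have hcT := hc.trans ht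
    have hwin : c - a ≤ h := by linarith
    have hxn := Real.rpow_nonneg (sub_nonneg.2 hac) β
    have hxε := H.rpow_le hβ hac hwin
    have hbc := hbmono c hc
    have hN := norm_increment_le_of_remainder (hD.rough.path a c ha0 hac hcT)
      (hY' a ⟨ha0, hac.trans hcT⟩) (hY.remainder a c ha0 hac hcT hwin)
    refine (hD.field.norm_comp_deriv_le hΛ0 ⟨ha0, hac.trans hcT⟩ ⟨ha0.trans hac, hcT⟩ hac rfl
      (hY' c ⟨ha0.trans hac, hcT⟩) (hY.deriv_holder a c ha0 hac hcT hwin) hN).trans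
      (mul_le_mul_of_nonneg_right ?_ hxn)
    have hx1 : (c - a) ^ β ≤ 1 := by linarith
    have hbx : B * Real.exp (c / h) * (c - a) ^ β ≤ b * 1 := mul_le_mul hbc hx1 hxn hb0
    have hεb : ε * (B * Real.exp (c / h)) ≤ 1 * b :=
      mul_le_mul (by linarith) hbc (by positivity) zero_le_one
    calc Λ * ((c - a) ^ β + (Λ * Λ + B * Real.exp (c / h) * (c - a) ^ β)) * Λ +
          Λ * (ε * (B * Real.exp (c / h)))
        ≤ Λ * (1 + (Λ * Λ + b * 1)) * Λ + Λ * (1 * b) := by gcongr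
      _ = Λ ^ 2 + Λ ^ 4 + Λ ^ 2 * b + Λ * b := by ring
      _ ≤ Λ ^ 5 + Λ ^ 5 + Λ ^ 5 * b + Λ ^ 5 * b := by gcongr
      _ ≤ _ := by nlinarith [mul_nonneg e5 hb0]

theorem IsPicardStep.norm_remainder_le (hD : RodeBound β T Λ X XX f₀ f) (hβ : 1 / 3 < β)
    {h ε B : ℝ} (H : IsScale β Λ h ε) (hB0 : 0 ≤ B)
    (hB : 32 * (sewingConst (3 * β) * Λ ^ 6) ≤ B)
    {Y Y₁ : ℝ → W} {Y' Y₁' : ℝ → V →L[ℝ] W} (hK : ControlledBound β T K X Y Y')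
    (hY : WeightedBound β T X h ε B Y Y') (hY' : ∀ t ∈ Icc 0 T, ‖Y' t‖ ≤ Λ)
    (hstep : IsPicardStep β T X XX f₀ f ξ Y Y' Y₁ Y₁') {s t : ℝ} (hs : 0 ≤ s) (hst : s ≤ t)
    (ht : t ≤ T) (hsth : t - s ≤ h) :
    ‖Y₁ t - Y₁ s - Y₁' s (X t - X s)‖ ≤ B * Real.exp (t / h) * ((t - s) ^ β) ^ 2 := by
  have hΛ1 := hD.one_le
  have hΛ0 : 0 ≤ Λ := by linarith
  have hε := H.ε_pos
  have hε1 := H.ε_le hβ hΛ1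
  have hε2 := H.ε_sq_le hβ hΛ1
  have hε3 := H.ε_cube_le hβ hΛ1
  have hεG := H.small
  have hs' : s ∈ Icc 0 T := ⟨hs, hst.trans ht⟩
  have hbt := H.le_weight hB0 (hs.trans hst)
  have herr := hstep.norm_picardError_le hD hβ H hB0 hK hY hY' hs hst ht hsth
  have hxε := H.rpow_le hβ hst hsth
  have hxn := Real.rpow_nonneg (sub_nonneg.2 hst) β
  have hbmono := fun c (hc : c ≤ t) => H.weight_mono hB0 hc
  have hx2 := hD.sub_le s t hs hst ht
  have hXX := hD.rough.area s t hs hst ht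
  have p3 := pow_le_sewingConst_mul_pow hβ hΛ1 (k := 3) (by norm_num)
  have p2 := pow_le_sewingConst_mul_pow hβ hΛ1 (k := 2) (by norm_num)
  generalize sewingConst (3 * β) * Λ ^ 6 = G at *
  generalize B * Real.exp (t / h) = b at *
  have hb0 : 0 ≤ b := hB0.trans hbt
  have hint : ‖∫ r in s..t, f₀ r (Y r)‖ ≤ Λ * (1 + ε ^ 3 * b) * (Λ * ((t - s) ^ β) ^ 2) := by
    have := intervalIntegral.norm_integral_le_of_norm_le_const (a := s) (b := t)
      (f := fun r => f₀ r (Y r)) (C := Λ * (1 + ε ^ 3 * b)) fun r hr => by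
        rw [uIoc_of_le hst] at hr
        have hr' : r ∈ Icc 0 T := ⟨hs.trans hr.1.le, hr.2.trans ht⟩
        refine (hD.drift.growth r hr' (Y r)).trans ?_
        have := (hY.value r hr').trans (mul_le_mul_of_nonneg_left (hbmono r hr.2) (by positivity))
        gcongr
    refine this.trans ?_
    rw [abs_of_nonneg (sub_nonneg.2 hst)]
    exact mul_le_mul_of_nonneg_left hx2 (by positivity)
  have htens : ‖tensorLift ((fderiv ℝ (f s) (Y s)).comp (Y' s)) (XX s t)‖ ≤
      Λ * Λ * (Λ * ((t - s) ^ β) ^ 2) :=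
    (norm_tensorLift_apply_le _ _).trans (mul_le_mul
      (ContinuousLinearMap.norm_comp_le_of_le (hD.field.norm_fderiv_le s hs' _) (hY' s hs'))
      hXX (norm_nonneg _) (by positivity))
  generalize (t - s) ^ β = x at *
  have hxε' : x ≤ ε := by linarith
  have hG0 : 0 ≤ G := (pow_nonneg hΛ0 2).trans p2
  have hε3' : ε ^ 3 ≤ ε := by linarith
  calc _ = ‖picardError X XX f₀ f Y Y' Y₁ s t + (∫ r in s..t, f₀ r (Y r)) +
        tensorLift ((fderiv ℝ (f s) (Y s)).comp (Y' s)) (XX s t)‖ := by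
        rw [picardError, germ, hstep.deriv s hs']; congr 1; abel
    _ ≤ _ := norm_add₃_le_of_le herr hint htens
    _ = (6 * G * (1 + b) * x + Λ ^ 2 * (1 + ε ^ 3 * b) + Λ ^ 3) * x ^ 2 := by ring
    _ ≤ (6 * G * (1 + b) * ε + G * (1 + ε * b) + G) * x ^ 2 := by
        gcongr
    _ ≤ b * x ^ 2 := by
        refine mul_le_mul_of_nonneg_right ?_ (sq_nonneg _)
        have h1 : G * ε * b ≤ 1 / 150 * b := by gcongr; linarith
        have h2 : G * ε ≤ G * 1 := by gcongr; linarith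
        linarith

/-- A priori bound: a large enough ball of the weighted norm is invariant under Picard steps. The
bound on the expansion error is linear in the norm, so that the scales `ε` and `h` do not depend
on the initial value. -/
theorem IsPicardStep.weightedBound (hD : RodeBound β T Λ X XX f₀ f) (hβ : 1 / 3 < β)
    {h ε B : ℝ} (H : IsScale β Λ h ε)
    (hB : 32 * (sewingConst (3 * β) * Λ ^ 6) * (1 + ‖ξ‖) ≤ ε ^ 3 * B)
    {Y Y₁ : ℝ → W} {Y' Y₁' : ℝ → V →L[ℝ] W} (hK : ControlledBound β T K X Y Y')
    (hY : WeightedBound β T X h ε B Y Y') (hY' : ∀ t ∈ Icc 0 T, ‖Y' t‖ ≤ Λ)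
    (hstep : IsPicardStep β T X XX f₀ f ξ Y Y' Y₁ Y₁') :
    WeightedBound β T X h ε B Y₁ Y₁' := by
  have hΛ1 := hD.one_le
  have hΛ0 : 0 ≤ Λ := by linarith
  have hε := H.ε_pos
  have hε1 := H.ε_le hβ hΛ1
  have hε2 := H.ε_sq_le hβ hΛ1
  have hε3 := H.ε_cube_le hβ hΛ1
  have hεG := H.small
  have hε0 : 0 ≤ ε ^ 3 := by positivity
  have p0 := pow_le_sewingConst_mul_pow hβ hΛ1 (k := 0) (by norm_num)
  have p1 := pow_le_sewingConst_mul_pow hβ hΛ1 (k := 1) (by norm_num)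
  have p2 := pow_le_sewingConst_mul_pow hβ hΛ1 (k := 2) (by norm_num)
  have p3 := pow_le_sewingConst_mul_pow hβ hΛ1 (k := 3) (by norm_num)
  have hrem := fun (hB0 : 0 ≤ B) (hBG : 32 * (sewingConst (3 * β) * Λ ^ 6) ≤ B)
    s t hs hst ht hsth => hstep.norm_remainder_le hD hβ H hB0 hBG hK hY hY' (s := s) (t := t) hs hst ht hsth
  generalize sewingConst (3 * β) * Λ ^ 6 = G at *
  rw [pow_zero] at p0
  rw [pow_one] at p1
  have hBG : 32 * G ≤ ε ^ 3 * B := by nlinarith [norm_nonneg ξ]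
  have hB0 : 0 ≤ B := by
    by_contra hneg
    have := mul_nonpos_of_nonneg_of_nonpos hε0 (not_le.1 hneg).le
    linarith
  have hB1 : ε ^ 3 * B ≤ B := mul_le_of_le_one_left hB0 (by linarith)
  replace hrem := hrem hB0 (by linarith)
  have hderiv : ∀ t ∈ Icc 0 T, ‖Y₁' t‖ ≤ Λ := fun t ht => by
    rw [hstep.deriv t ht]; exact hD.field.norm_le t ht _
  refine ⟨fun t ht => ?_, fun t ht => ?_, fun s t hs hst ht hsth => ?_, hrem⟩
  · have hwin := norm_le_of_window_increments (A := Y₁) (T := T) H.h_pos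
      (D := (G + ε ^ 3 * B) * ε ^ 3) (by positivity) (fun s t hs hst ht hsth => by
        have hxn := Real.rpow_nonneg (sub_nonneg.2 hst) β
        have hxε := H.rpow_le hβ hst hsth
        have hw := H.le_weight (B := G) (by linarith) (hs.trans hst)
        refine (norm_increment_le_of_remainder (hD.rough.path s t hs hst ht)
          (hderiv s ⟨hs, hst.trans ht⟩) (hrem s t hs hst ht hsth)).trans ?_
        have hΛG : Λ * Λ ≤ G * Real.exp (t / h) := by
          rw [← pow_two]; exact p2.trans hw
        calc (Λ * Λ + B * Real.exp (t / h) * (t - s) ^ β) * (t - s) ^ β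
            ≤ (G * Real.exp (t / h) + B * Real.exp (t / h) * ε ^ 3) * ε ^ 3 :=
              mul_le_mul (add_le_add hΛG (by gcongr)) hxε hxn (by positivity)
          _ = _ := by ring) ht
    rw [hstep.init] at hwin
    refine hwin.trans ?_
    have hξ : ‖ξ‖ ≤ ε ^ 3 * B / 32 := by nlinarith [norm_nonneg ξ]
    have hw := H.le_weight (B := ε ^ 3 * B / 32) (by positivity) ht.1
    have h2 : (G + ε ^ 3 * B) * ε ^ 3 ≤ (ε ^ 3 * B / 32 + ε ^ 3 * B) * (1 / 150) := by
      gcongr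
      · linarith
      · linarith
    have h3 := mul_le_mul_of_nonneg_right h2 (Real.exp_pos (t / h)).le
    have : 0 ≤ ε ^ 3 * B * Real.exp (t / h) := by positivity
    linarith
  · refine (hderiv t ht).trans ?_
    have := H.le_weight hB0 ht.1
    have : ε ^ 3 * B ≤ ε ^ 2 * (B * Real.exp (t / h)) := by gcongr
    linarith
  · have hs' : s ∈ Icc 0 T := ⟨hs, hst.trans ht⟩
    have ht' : t ∈ Icc 0 T := ⟨hs.trans hst, ht⟩
    have hbt := H.le_weight hB0 (hs.trans hst)
    have hxε := H.rpow_le hβ hst hsth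
    have hxn := Real.rpow_nonneg (sub_nonneg.2 hst) β
    have hinc := norm_increment_le_of_remainder (hD.rough.path s t hs hst ht)
      (hY' s hs') (hY.remainder s t hs hst ht hsth)
    have a1 := hD.field.time s hs' t ht' hst (Y t)
    have a2 := (hD.field.lipschitz hs' (Y t) (Y s)).trans (mul_le_mul_of_nonneg_left hinc hΛ0)
    rw [hstep.deriv t ht', hstep.deriv s hs']
    generalize B * Real.exp (t / h) = b at *
    generalize (t - s) ^ β = x at *
    have hb0 : 0 ≤ b := hB0.trans hbt
    calc _ = ‖(f t (Y t) - f s (Y t)) + (f s (Y t) - f s (Y s))‖ := by rw [sub_add_sub_cancel]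
      _ ≤ _ := (norm_add_le _ _).trans (add_le_add a1 a2)
      _ = (Λ * x + Λ ^ 3 + Λ * b * x) * x := by ring
      _ ≤ (G * 1 + G + G * b * ε ^ 2) * x := by
        gcongr
        · linarith
        · linarith
      _ ≤ _ := by
        refine mul_le_mul_of_nonneg_right ?_ hxn
        have hGb : ε ^ 3 * B ≤ ε * b := by gcongr; linarith
        have h1 : G * b * ε ^ 2 ≤ 1 / 150 * (ε * b) := by
          calc G * b * ε ^ 2 = G * ε * (ε * b) := by ring
            _ ≤ _ := by gcongr; linarith
        linarith

end Weighted

/-! ### Contraction -/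

section Contraction

variable {V W : Type*} [NormedAddCommGroup V] [NormedSpace ℝ V]
  [NormedAddCommGroup W] [NormedSpace ℝ W]
  {β T Λ K : ℝ} {X : ℝ → V} {XX : ℝ → ℝ → ProjTensor V} {f₀ : ℝ → W → W}
  {f : ℝ → W → V →L[ℝ] W} {ξ : W}

variable {h ε B : ℝ} {Y Y₁ Z Z₁ : ℝ → W} {Y' Y₁' Z' Z₁' : ℝ → V →L[ℝ] W}

/-- On a window that ends before `t`, all distances are measured with the weight at `t`. -/
theorem WeightedBound.pairBound (hD : RodeBound β T K X XX f₀ f) (H : IsScale β K h ε) (hB : 0 ≤ B)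
    (hY : ControlledBound β T K X Y Y') (hZ : ControlledBound β T K X Z Z')
    (hA : WeightedBound β T X h ε B (fun t => Y t - Z t) (fun t => Y' t - Z' t)) {a c t : ℝ}
    (ha : 0 ≤ a) (hac : a ≤ c) (hc : c ≤ T) (hwin : c - a ≤ h) (hct : c ≤ t) :
    PairBound K ((c - a) ^ β) (ε ^ 3 * (B * Real.exp (t / h))) (ε ^ 2 * (B * Real.exp (t / h)))
      (ε * (B * Real.exp (t / h))) (B * Real.exp (t / h)) (X c - X a) (Y a) (Y c) (Z a) (Z c)
      (Y' a) (Y' c) (Z' a) (Z' c) := by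
  have hxn := Real.rpow_nonneg (sub_nonneg.2 hac) β
  have ha' : a ∈ Icc 0 T := ⟨ha, hac.trans hc⟩
  have hc' : c ∈ Icc 0 T := ⟨ha.trans hac, hc⟩
  have hε := H.ε_pos
  have h1 := H.weight_mono hB (hac.trans hct)
  have h2 := H.weight_mono hB hct
  exact
    { x_nonneg := hxn
      x_le := hD.rpow_le a c ha hac hc
      one_le := hD.one_le
      norm_le := hD.rough.path a c ha hac hc
      left_deriv₀ := hY.deriv a ha'
      left_deriv₁ := hY.deriv c hc'
      right_deriv₀ := hZ.deriv a ha'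
      left_deriv_sub := hY.deriv_holder a c ha hac hc
      left_remainder := hY.remainder a c ha hac hc
      right_remainder := hZ.remainder a c ha hac hc
      diff₀ := (hA.value a ha').trans (mul_le_mul_of_nonneg_left h1 (by positivity))
      diff₁ := (hA.value c hc').trans (mul_le_mul_of_nonneg_left h2 (by positivity))
      diff_deriv₀ := (hA.deriv a ha').trans (mul_le_mul_of_nonneg_left h1 (by positivity))
      diff_deriv₁ := (hA.deriv c hc').trans (mul_le_mul_of_nonneg_left h2 (by positivity))
      diff_deriv_sub := (hA.deriv_holder a c ha hac hc hwin).trans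
        (mul_le_mul_of_nonneg_right (mul_le_mul_of_nonneg_left h2 (by positivity)) hxn)
      diff_remainder := (hA.remainder a c ha hac hc hwin).trans
        (mul_le_mul_of_nonneg_right h2 (sq_nonneg _)) }

variable [CompleteSpace W]

theorem IsPicardStep.norm_picardError_sub_le (hD : RodeBound β T K X XX f₀ f) (hβ : 1 / 3 < β)
    (H : IsScale β K h ε) (hB : 0 ≤ B)
    (hY : ControlledBound β T K X Y Y') (hZ : ControlledBound β T K X Z Z')
    (hsY : IsPicardStep β T X XX f₀ f ξ Y Y' Y₁ Y₁')
    (hsZ : IsPicardStep β T X XX f₀ f ξ Z Z' Z₁ Z₁')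
    (hA : WeightedBound β T X h ε B (fun t => Y t - Z t) (fun t => Y' t - Z' t)) {s t : ℝ}
    (hs : 0 ≤ s) (hst : s ≤ t) (ht : t ≤ T) (hsth : t - s ≤ h) :
    ‖picardError X XX f₀ f Y Y' Y₁ s t - picardError X XX f₀ f Z Z' Z₁ s t‖ ≤
      72 * (sewingConst (3 * β) * K ^ 6) * (B * Real.exp (t / h)) * ((t - s) ^ β) ^ 3 := by
  have hK1 := hD.one_le
  have hK0 : 0 ≤ K := by linarith
  have hε := H.ε_pos
  have hε1 := H.ε_le hβ hK1
  have hε2 := H.ε_sq_le hβ hK1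
  have hε3 := H.ε_cube_le hβ hK1
  obtain ⟨m₁, hm₁⟩ := hsY.expansion
  obtain ⟨m₂, hm₂⟩ := hsZ.expansion
  have hpair := fun a c ha hac hc hwin hct =>
    hA.pairBound hD H hB hY hZ (a := a) (c := c) (t := t) ha hac hc hwin hct
  have hb0 : 0 ≤ B * Real.exp (t / h) := by positivity
  generalize B * Real.exp (t / h) = b at hpair hb0
  have hα : ε ^ 3 * b ≤ b := mul_le_of_le_one_left hb0 (by linarith)
  have hα' : ε ^ 2 * b ≤ b := mul_le_of_le_one_left hb0 (by linarith)
  have hρ : ε * b ≤ b := mul_le_of_le_one_left hb0 (by linarith)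
  have hK5 := pow_nonneg hK0 5
  refine (hD.rough.norm_le_of_germ hβ hK0
    (J := fun s t => picardError X XX f₀ f Y Y' Y₁ s t - picardError X XX f₀ f Z Z' Z₁ s t)
    (Z := fun r => f r (Y r) - f r (Z r))
    (Z' := fun r => (fderiv ℝ (f r) (Y r)).comp (Y' r) - (fderiv ℝ (f r) (Z r)).comp (Z' r))
    (m := m₁ + m₂) (fun s u t hs hsu hut ht => ?_) (fun s t hs hst ht => ?_)
    hs hst ht (C := 36 * K ^ 5 * b) (by positivity) (fun a c ha hac hc => ?_)
    (fun a c ha hac hc => ?_)).trans (le_of_eq (by ring))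
  · have d1 := hY.picardError_defect hD (by linarith) Y₁ hs hsu hut ht
    have d2 := hZ.picardError_defect hD (by linarith) Z₁ hs hsu hut ht
    have e : ∀ a b c a' b' c' : W, a - a' - (b - b') - (c - c') =
        (a - b - c) - (a' - b' - c') := fun a b c a' b' c' => by abel
    simp only [germ_sub]
    rw [e, e, d1, d2]
    abel
  · rw [add_mul]
    exact (norm_sub_le _ _).trans (add_le_add (hm₁ s t hs hst ht) (hm₂ s t hs hst ht))
  · have ha0 := hs.trans ha
    have hcT := hc.trans ht
    refine ((hpair a c ha0 hac hcT (by linarith) hc).norm_comp_remainder_sub_le hD.field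
      ⟨ha0, hac.trans hcT⟩ ⟨ha0.trans hac, hcT⟩ hac rfl hb0).trans
      (mul_le_mul_of_nonneg_right ?_ (sq_nonneg _))
    calc 10 * K ^ 5 * (ε ^ 3 * b + ε ^ 2 * b + b) ≤ 10 * K ^ 5 * (b + b + b) := by gcongr
      _ ≤ _ := by nlinarith [mul_nonneg hK5 hb0]
  · have ha0 := hs.trans ha
    have hcT := hc.trans ht
    refine ((hpair a c ha0 hac hcT (by linarith) hc).norm_fderiv_comp_sub_le hD.field
      ⟨ha0, hac.trans hcT⟩ ⟨ha0.trans hac, hcT⟩ hac rfl hb0 (by positivity)).trans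
      (mul_le_mul_of_nonneg_right ?_ (Real.rpow_nonneg (sub_nonneg.2 hac) β))
    calc 9 * K ^ 5 * (ε ^ 3 * b + ε ^ 2 * b + ε * b + b) ≤ 9 * K ^ 5 * (b + b + b + b) := by gcongr
      _ = _ := by ring

theorem IsPicardStep.norm_remainder_sub_le (hD : RodeBound β T K X XX f₀ f) (hβ : 1 / 3 < β)
    (H : IsScale β K h ε) (hB : 0 ≤ B)
    (hY : ControlledBound β T K X Y Y') (hZ : ControlledBound β T K X Z Z')
    (hsY : IsPicardStep β T X XX f₀ f ξ Y Y' Y₁ Y₁')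
    (hsZ : IsPicardStep β T X XX f₀ f ξ Z Z' Z₁ Z₁')
    (hA : WeightedBound β T X h ε B (fun t => Y t - Z t) (fun t => Y' t - Z' t)) {s t : ℝ}
    (hs : 0 ≤ s) (hst : s ≤ t) (ht : t ≤ T) (hsth : t - s ≤ h) :
    ‖(Y₁ t - Z₁ t) - (Y₁ s - Z₁ s) - (Y₁' s - Z₁' s) (X t - X s)‖ ≤
      B / 2 * Real.exp (t / h) * ((t - s) ^ β) ^ 2 := by
  have hK1 := hD.one_le
  have hK0 : 0 ≤ K := by linarith
  have hε := H.ε_pos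
  have hε1 := H.ε_le hβ hK1
  have hε2 := H.ε_sq_le hβ hK1
  have hε3 := H.ε_cube_le hβ hK1
  have hεG := H.small
  have hs' : s ∈ Icc 0 T := ⟨hs, hst.trans ht⟩
  have ht' : t ∈ Icc 0 T := ⟨hs.trans hst, ht⟩
  have herr := hsY.norm_picardError_sub_le hD hβ H hB hY hZ hsZ hA hs hst ht hsth
  have hpair := hA.pairBound hD H hB hY hZ hs hst ht hsth le_rfl
  have hxε := H.rpow_le hβ hst hsth
  have hbmono := fun c (hc : c ≤ t) => H.weight_mono hB hc
  have hx2 := hD.sub_le s t hs hst ht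
  have hXX := hD.rough.area s t hs hst ht
  have p3 := pow_le_sewingConst_mul_pow hβ hK1 (k := 3) (by norm_num)
  have p2 := pow_le_sewingConst_mul_pow hβ hK1 (k := 2) (by norm_num)
  rw [show B / 2 * Real.exp (t / h) = B * Real.exp (t / h) / 2 by ring]
  have hb0 : 0 ≤ B * Real.exp (t / h) := by positivity
  generalize sewingConst (3 * β) * K ^ 6 = G at *
  generalize B * Real.exp (t / h) = b at *
  have hint : ‖∫ r in s..t, (f₀ r (Y r) - f₀ r (Z r))‖ ≤
      K * (ε ^ 3 * b) * (K * ((t - s) ^ β) ^ 2) := by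
    have := intervalIntegral.norm_integral_le_of_norm_le_const (a := s) (b := t)
      (f := fun r => f₀ r (Y r) - f₀ r (Z r)) (C := K * (ε ^ 3 * b)) fun r hr => by
        rw [uIoc_of_le hst] at hr
        have hr' : r ∈ Icc 0 T := ⟨hs.trans hr.1.le, hr.2.trans ht⟩
        exact (hD.drift.lipschitz r hr' (Y r) (Z r)).trans (mul_le_mul_of_nonneg_left
          ((hA.value r hr').trans (mul_le_mul_of_nonneg_left (hbmono r hr.2) (by positivity))) hK0)
    refine this.trans ?_
    rw [abs_of_nonneg (sub_nonneg.2 hst)]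
    exact mul_le_mul_of_nonneg_left hx2 (by positivity)
  rw [intervalIntegral.integral_sub (hY.intervalIntegrable hD (by linarith) hs' ht')
    (hZ.intervalIntegrable hD (by linarith) hs' ht')] at hint
  have hderiv : ‖(fderiv ℝ (f s) (Y s)).comp (Y' s) - (fderiv ℝ (f s) (Z s)).comp (Z' s)‖ ≤
      K * (ε ^ 3 * b) * K + K * (ε ^ 2 * b) := by
    have e : (fderiv ℝ (f s) (Y s)).comp (Y' s) - (fderiv ℝ (f s) (Z s)).comp (Z' s) =
        (fderiv ℝ (f s) (Y s) - fderiv ℝ (f s) (Z s)).comp (Y' s) +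
          (fderiv ℝ (f s) (Z s)).comp (Y' s - Z' s) := by
      rw [ContinuousLinearMap.sub_comp, ContinuousLinearMap.comp_sub]; abel
    rw [e]
    exact (norm_add_le _ _).trans (add_le_add
      (ContinuousLinearMap.norm_comp_le_of_le ((hD.field.lipschitz_fderiv hs' _ _).trans
        (mul_le_mul_of_nonneg_left hpair.diff₀ hK0)) hpair.left_deriv₀)
      (ContinuousLinearMap.norm_comp_le_of_le (hD.field.norm_fderiv_le s hs' _)
        hpair.diff_deriv₀))
  have htens : ‖tensorLift ((fderiv ℝ (f s) (Y s)).comp (Y' s) -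
      (fderiv ℝ (f s) (Z s)).comp (Z' s)) (XX s t)‖ ≤
      (K * (ε ^ 3 * b) * K + K * (ε ^ 2 * b)) * (K * ((t - s) ^ β) ^ 2) :=
    (norm_tensorLift_apply_le _ _).trans (mul_le_mul hderiv hXX (norm_nonneg _) (by positivity))
  have hx0 := hpair.x_nonneg
  generalize (t - s) ^ β = x at *
  have hxε' : x ≤ ε := by linarith
  have hε3' : ε ^ 3 ≤ ε := by linarith
  have hG0 : 0 ≤ G := (pow_nonneg hK0 2).trans p2
  calc _ = ‖(picardError X XX f₀ f Y Y' Y₁ s t - picardError X XX f₀ f Z Z' Z₁ s t) +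
        ((∫ r in s..t, f₀ r (Y r)) - ∫ r in s..t, f₀ r (Z r)) +
        tensorLift ((fderiv ℝ (f s) (Y s)).comp (Y' s) -
          (fderiv ℝ (f s) (Z s)).comp (Z' s)) (XX s t)‖ := by
        rw [picardError, picardError, germ, germ, hsY.deriv s hs', hsZ.deriv s hs',
          tensorLift_sub, sub_apply]
        congr 1; abel
    _ ≤ _ := norm_add₃_le_of_le herr hint htens
    _ = (72 * G * b * x + K ^ 2 * ε ^ 3 * b + K ^ 3 * ε ^ 3 * b + K ^ 2 * ε ^ 2 * b) * x ^ 2 := by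
        ring
    _ ≤ (72 * G * b * ε + G * ε * b + G * ε * b + G * ε * b) * x ^ 2 := by
        gcongr
    _ ≤ b / 2 * x ^ 2 := by
        refine mul_le_mul_of_nonneg_right ?_ (sq_nonneg _)
        have h1 : 150 * G * ε * b ≤ 1 * b := mul_le_mul_of_nonneg_right (by linarith) hb0
        linarith

/-- Contraction: a Picard step halves the weighted distance of two controlled paths. -/
theorem IsPicardStep.weightedBound_sub (hD : RodeBound β T K X XX f₀ f) (hβ : 1 / 3 < β)
    (H : IsScale β K h ε) (hB : 0 ≤ B)
    (hY : ControlledBound β T K X Y Y') (hZ : ControlledBound β T K X Z Z')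
    (hsY : IsPicardStep β T X XX f₀ f ξ Y Y' Y₁ Y₁')
    (hsZ : IsPicardStep β T X XX f₀ f ξ Z Z' Z₁ Z₁')
    (hA : WeightedBound β T X h ε B (fun t => Y t - Z t) (fun t => Y' t - Z' t)) :
    WeightedBound β T X h ε (B / 2) (fun t => Y₁ t - Z₁ t) (fun t => Y₁' t - Z₁' t) := by
  have hK1 := hD.one_le
  have hK0 : 0 ≤ K := by linarith
  have hε := H.ε_pos
  have hε1 := H.ε_le hβ hK1
  have hε2 := H.ε_sq_le hβ hK1
  have hε3 := H.ε_cube_le hβ hK1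
  have hεG := H.small
  have p1 := pow_le_sewingConst_mul_pow hβ hK1 (k := 1) (by norm_num)
  have p3 := pow_le_sewingConst_mul_pow hβ hK1 (k := 3) (by norm_num)
  generalize sewingConst (3 * β) * K ^ 6 = G at *
  rw [pow_one] at p1
  have hKε : K * ε ≤ 1 / 150 := by
    have : K * ε ≤ G * ε := by gcongr
    linarith
  have hrem := fun s t hs hst ht hsth =>
    hsY.norm_remainder_sub_le hD hβ H hB hY hZ hsZ hA (s := s) (t := t) hs hst ht hsth
  have hderiv : ∀ t ∈ Icc 0 T, ‖Y₁' t - Z₁' t‖ ≤ ε ^ 2 * (B / 2 * Real.exp (t / h)) := by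
    intro t ht
    rw [hsY.deriv t ht, hsZ.deriv t ht]
    refine ((hD.field.lipschitz ht _ _).trans
      (mul_le_mul_of_nonneg_left (hA.value t ht) hK0)).trans ?_
    calc K * (ε ^ 3 * (B * Real.exp (t / h))) = K * ε * (ε ^ 2 * (B * Real.exp (t / h))) := by ring
      _ ≤ 1 / 2 * (ε ^ 2 * (B * Real.exp (t / h))) := by gcongr; linarith
      _ = _ := by ring
  refine ⟨fun t ht => ?_, hderiv, fun s t hs hst ht hsth => ?_, hrem⟩
  · have hwin := norm_le_of_window_increments (A := fun t => Y₁ t - Z₁ t) (T := T) H.h_pos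
      (D := (1 / 4 * (B / 2)) * ε ^ 3) (by positivity) (fun s t hs hst ht hsth => by
        have hxn := Real.rpow_nonneg (sub_nonneg.2 hst) β
        have hxε := H.rpow_le hβ hst hsth
        have hds := (hderiv s ⟨hs, hst.trans ht⟩).trans
          (mul_le_mul_of_nonneg_left (H.weight_mono (by linarith : 0 ≤ B / 2) hst) (sq_nonneg ε))
        refine (norm_increment_le_of_remainder (hD.rough.path s t hs hst ht)
          hds (hrem s t hs hst ht hsth)).trans ?_
        have hb0 : 0 ≤ B / 2 * Real.exp (t / h) := by positivity
        calc (ε ^ 2 * (B / 2 * Real.exp (t / h)) * K +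
              B / 2 * Real.exp (t / h) * (t - s) ^ β) * (t - s) ^ β
            ≤ (ε ^ 2 * (B / 2 * Real.exp (t / h)) * K +
              B / 2 * Real.exp (t / h) * ε ^ 3) * ε ^ 3 := by gcongr
          _ = ((ε * (K * ε) + ε ^ 3) * (B / 2 * Real.exp (t / h))) * ε ^ 3 := by ring
          _ ≤ ((1 / 150 * (1 / 150) + 1 / 150) * (B / 2 * Real.exp (t / h))) * ε ^ 3 := by
            gcongr
            linarith
          _ ≤ (1 / 4 * (B / 2 * Real.exp (t / h))) * ε ^ 3 := by
            gcongr
            norm_num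
          _ = _ := by ring) ht
    rw [hsY.init, hsZ.init, sub_self, norm_zero, zero_add] at hwin
    refine hwin.trans ?_
    have : 0 ≤ ε ^ 3 * (B / 2 * Real.exp (t / h)) := by positivity
    linarith
  · have hs' : s ∈ Icc 0 T := ⟨hs, hst.trans ht⟩
    have ht' : t ∈ Icc 0 T := ⟨hs.trans hst, ht⟩
    have hpair := hA.pairBound hD H hB hY hZ hs hst ht hsth le_rfl
    have hxε := H.rpow_le hβ hst hsth
    have hxn := Real.rpow_nonneg (sub_nonneg.2 hst) β
    rw [show B / 2 * Real.exp (t / h) = B * Real.exp (t / h) / 2 by ring]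
    have hb0 : 0 ≤ B * Real.exp (t / h) := by positivity
    have hfield := hpair.norm_field_sub_le hD.field hs' ht' hst rfl hb0
    rw [hsY.deriv t ht', hsY.deriv s hs', hsZ.deriv t ht', hsZ.deriv s hs']
    generalize B * Real.exp (t / h) = b at *
    refine hfield.trans (mul_le_mul_of_nonneg_right ?_ hxn)
    have hxε2 : (t - s) ^ β ≤ ε ^ 2 := by linarith
    have hG0 : 0 ≤ G := hK0.trans p1
    calc 3 * K ^ 3 * (ε ^ 3 * b + ε ^ 2 * b + b * (t - s) ^ β)
        ≤ 3 * G * (ε ^ 2 * b + ε ^ 2 * b + b * ε ^ 2) := by gcongr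
      _ = 9 * (G * ε) * (ε * b) := by ring
      _ ≤ 9 * (1 / 150) * (ε * b) := by gcongr; linarith
      _ ≤ _ := by
        have : 0 ≤ ε * b := by positivity
        linarith

end Contraction

/-! ### Solutions as fixed points of the Picard map -/

section Solution

variable {V W : Type*} [NormedAddCommGroup V] [NormedSpace ℝ V]
  [NormedAddCommGroup W] [NormedSpace ℝ W]
  {β T Λ K : ℝ} {X : ℝ → V} {XX : ℝ → ℝ → ProjTensor V} {f₀ : ℝ → W → W}
  {f : ℝ → W → V →L[ℝ] W} {ξ : W} {Y Z : ℝ → W} {Y' Z' : ℝ → V →L[ℝ] W}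

theorem finiteHolder_of_le {E : Type*} [NormedAddCommGroup E] {γ C : ℝ} {Ξ : ℝ → ℝ → E}
    (h : ∀ s t, 0 ≤ s → s ≤ t → t ≤ T → ‖Ξ s t‖ ≤ C * (t - s) ^ γ)
    (h' : ∀ s t, 0 ≤ s → s ≤ t → t ≤ T → ‖Ξ t s‖ ≤ C * (t - s) ^ γ) : FiniteHolder γ T Ξ := by
  refine ⟨C, fun s hs t ht _ => ?_⟩
  rcases le_total s t with hst | hst
  · rw [abs_of_nonneg (sub_nonneg.2 hst)]
    exact h s t hs.1 hst ht.2
  · rw [abs_sub_comm, abs_of_nonneg (sub_nonneg.2 hst)]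
    exact h' t s ht.1 hst hs.2

theorem ControlledBound.isControlled (h : ControlledBound β T K X Y Y')
    (hD : RodeBound β T Λ X XX f₀ f) (hT : 0 ≤ T) : IsControlled β T X Y Y' where
  holder_path := finiteHolder_of_le (fun _ _ => h.path hD) fun s t hs hst ht => by
    rw [norm_sub_rev]
    exact h.path hD hs hst ht
  holder_deriv := finiteHolder_of_le h.deriv_holder fun s t hs hst ht => by
    rw [norm_sub_rev]
    exact h.deriv_holder s t hs hst ht
  holder_remainder := by
    have hK : 0 ≤ K := (norm_nonneg _).trans (h.value 0 ⟨le_rfl, hT⟩)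
    have hΛ : 0 ≤ Λ := by linarith [hD.one_le]
    refine finiteHolder_of_le (C := K * Λ + K) (fun s t hs hst ht => ?_) fun s t hs hst ht => ?_
    · rw [rpow_mul_two_of_nonneg (sub_nonneg.2 hst)]
      refine (h.remainder s t hs hst ht).trans ?_
      gcongr
      exact le_add_of_nonneg_left (by positivity)
    · rw [rpow_mul_two_of_nonneg (sub_nonneg.2 hst)]
      have h1 := h.remainder s t hs hst ht
      have h2 : ‖(Y' t - Y' s) (X t - X s)‖ ≤ K * (t - s) ^ β * (Λ * (t - s) ^ β) :=
        (ContinuousLinearMap.le_opNorm _ _).trans (mul_le_mul (h.deriv_holder s t hs hst ht)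
          (hD.rough.path s t hs hst ht) (norm_nonneg _)
          (mul_nonneg hK (Real.rpow_nonneg (sub_nonneg.2 hst) β)))
      calc _ = ‖(Y' t - Y' s) (X t - X s) - (Y t - Y s - Y' s (X t - X s))‖ := by
            congr 1; simp only [sub_apply, map_sub]; abel
        _ ≤ _ := (norm_sub_le _ _).trans (add_le_add h2 h1)
        _ = _ := by ring

theorem IsControlled.exists_controlledBound (h : IsControlled β T X Y Y') (hβ : 0 < β) :
    ∃ K, ControlledBound β T K X Y Y' := by
  obtain ⟨C₁, h₁⟩ := h.holder_path.exists_bound (by simp)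
  obtain ⟨C₂, h₂⟩ := h.holder_deriv.exists_bound (by simp)
  obtain ⟨C₃, h₃⟩ := h.holder_remainder.exists_bound (by simp)
  obtain ⟨M₁, hM₁⟩ := isCompact_Icc.exists_bound_of_continuousOn
    (continuousOn_of_norm_sub_le_rpow hβ (h₁ C₁ le_rfl))
  obtain ⟨M₂, hM₂⟩ := isCompact_Icc.exists_bound_of_continuousOn
    (continuousOn_of_norm_sub_le_rpow hβ (h₂ C₂ le_rfl))
  obtain ⟨K, hK⟩ := (Set.toFinite {C₂, C₃, M₁, M₂}).bddAbove
  have hK2 : C₂ ≤ K := hK (by simp)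
  have hK3 : C₃ ≤ K := hK (by simp)
  refine ⟨K, fun t ht => (hM₁ t ht).trans (hK (by simp)), fun t ht => (hM₂ t ht).trans
    (hK (by simp)), h₂ K hK2, fun s t hs hst ht => ?_⟩
  rw [← rpow_mul_two_of_nonneg (sub_nonneg.2 hst)]
  exact h₃ K hK3 s t hs hst ht

theorem ControlledBound.exists_weightedBound_sub (hY : ControlledBound β T K X Y Y')
    (hZ : ControlledBound β T K X Z Z') (hβ : 1 / 3 < β) (hK : 1 ≤ K) {h ε : ℝ}
    (H : IsScale β K h ε) :
    ∃ B, 0 ≤ B ∧ WeightedBound β T X h ε B (fun t => Y t - Z t) (fun t => Y' t - Z' t) := by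
  have hε := H.ε_pos
  have hε1 := H.ε_le hβ hK
  have hε2 := H.ε_sq_le hβ hK
  have hε3 := H.ε_cube_le hβ hK
  have hB0 : 0 ≤ 2 * K / ε ^ 3 := by positivity
  have hB : ε ^ 3 * (2 * K / ε ^ 3) = 2 * K := by field_simp
  have hweight : ∀ δ, ε ^ 3 ≤ δ → ∀ t, 0 ≤ t → 2 * K ≤ δ * (2 * K / ε ^ 3 * Real.exp (t / h)) :=
    fun δ hδ t ht => by
      have h1 := H.le_weight hB0 ht
      refine hB.symm.trans_le ?_
      exact mul_le_mul hδ h1 hB0 (by linarith [pow_pos hε 3])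
  refine ⟨2 * K / ε ^ 3, hB0, fun t ht => ?_, fun t ht => ?_, fun s t hs hst ht _ => ?_,
    fun s t hs hst ht _ => ?_⟩
  · refine ((norm_sub_le _ _).trans (add_le_add (hY.value t ht) (hZ.value t ht))).trans ?_
    linarith [hweight _ le_rfl t ht.1]
  · refine ((norm_sub_le _ _).trans (add_le_add (hY.deriv t ht) (hZ.deriv t ht))).trans ?_
    linarith [hweight _ hε3 t ht.1]
  · have hx := Real.rpow_nonneg (sub_nonneg.2 hst) β
    rw [sub_sub_sub_comm]
    refine ((norm_sub_le _ _).trans (add_le_add (hY.deriv_holder s t hs hst ht)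
      (hZ.deriv_holder s t hs hst ht))).trans ?_
    rw [← two_mul, ← mul_assoc]
    exact mul_le_mul_of_nonneg_right (hweight _ (by linarith) t (hs.trans hst)) hx
  · have e : Y t - Z t - (Y s - Z s) - (Y' s - Z' s) (X t - X s) =
        (Y t - Y s - Y' s (X t - X s)) - (Z t - Z s - Z' s (X t - X s)) := by
      rw [sub_apply]; abel
    rw [e]
    refine ((norm_sub_le _ _).trans (add_le_add (hY.remainder s t hs hst ht)
      (hZ.remainder s t hs hst ht))).trans ?_
    rw [← two_mul, ← mul_assoc]
    refine mul_le_mul_of_nonneg_right ?_ (sq_nonneg _)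
    simpa using hweight 1 (by linarith) t (hs.trans hst)

variable [CompleteSpace W]

theorem IsPicardStep.hasRoughIntegral {Y₁ : ℝ → W} {Y₁' : ℝ → V →L[ℝ] W}
    (hstep : IsPicardStep β T X XX f₀ f ξ Y Y' Y₁ Y₁') (h : ControlledBound β T K X Y Y')
    (hD : RodeBound β T Λ X XX f₀ f) (hβ : 1 / 3 < β) {t : ℝ} (ht : t ∈ Icc 0 T) :
    HasRoughIntegral X XX (fun r => f r (Y r)) (fun r => (fderiv ℝ (f r) (Y r)).comp (Y' r)) 0 t
      (Y₁ t - ξ - ∫ r in (0 : ℝ)..t, f₀ r (Y r)) := by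
  obtain ⟨m, hm⟩ := hstep.expansion
  have hint := hasRoughIntegral_of_expansion (X := X) (XX := XX) (Z := fun r => f r (Y r))
    (Z' := fun r => (fderiv ℝ (f r) (Y r)).comp (Y' r))
    (I := fun t => Y₁ t - ∫ r in (0 : ℝ)..t, f₀ r (Y r)) (θ := 3 * β) (m := max m 0) (b := t)
    (by linarith) (le_max_right _ _) ht.1 fun s u hs hsu hu => by
      rw [rpow_mul_three_of_nonneg (sub_nonneg.2 hsu)]
      have hu' : u ∈ Icc 0 T := ⟨hs.trans hsu, hu.trans ht.2⟩
      have hs' : s ∈ Icc 0 T := ⟨hs, hsu.trans hu'.2⟩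
      have h0 : (0 : ℝ) ∈ Icc 0 T := ⟨le_rfl, ht.1.trans ht.2⟩
      have e := intervalIntegral.integral_add_adjacent_intervals
        (h.intervalIntegrable hD (by linarith) h0 hs')
        (h.intervalIntegrable hD (by linarith) hs' hu')
      have hx := Real.rpow_nonneg (sub_nonneg.2 hsu) β
      refine le_trans (le_of_eq ?_) ((hm s u hs hsu hu'.2).trans
        (mul_le_mul_of_nonneg_right (le_max_left m 0) (by positivity)))
      rw [picardError, ← e]
      congr 1
      abel
  convert hint using 1
  simp only [intervalIntegral.integral_same, hstep.init]
  abel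

/-- A controlled fixed point of the Picard map is a solution. -/
theorem IsPicardStep.isRODESolution (hstep : IsPicardStep β T X XX f₀ f ξ Y Y' Y Y')
    (h : ControlledBound β T K X Y Y') (hD : RodeBound β T Λ X XX f₀ f) (hβ : 1 / 3 < β)
    (hT : 0 ≤ T) : IsRODESolution β T X XX f₀ f ξ Y Y' where
  controlled := h.isControlled hD hT
  deriv_eq := hstep.deriv
  integral_eq t ht := ⟨_, hstep.hasRoughIntegral h hD hβ ht, by abel⟩

/-- A solution is a fixed point of the Picard map: by the sewing lemma some path has the one-step
expansion, and it agrees with the solution because rough integrals are unique. -/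
theorem IsRODESolution.isPicardStep (hsol : IsRODESolution β T X XX f₀ f ξ Y Y')
    (h : ControlledBound β T K X Y Y') (hD : RodeBound β T Λ X XX f₀ f) (hβ : 1 / 3 < β)
    (hT : 0 ≤ T) : IsPicardStep β T X XX f₀ f ξ Y Y' Y Y' := by
  obtain ⟨Y₁, hstep⟩ := h.exists_isPicardStep hD hβ hT ξ
  have heq : ∀ t ∈ Icc 0 T, Y t = Y₁ t := by
    intro t ht
    obtain ⟨I, hI, hY⟩ := hsol.integral_eq t ht
    rw [hY, hI.unique ht.1 (hstep.hasRoughIntegral h hD hβ ht)]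
    abel
  obtain ⟨m, hm⟩ := hstep.expansion
  refine ⟨(heq 0 ⟨le_rfl, hT⟩).trans hstep.init, hsol.deriv_eq, m, fun s t hs hst ht => ?_⟩
  have := hm s t hs hst ht
  rwa [picardError, ← heq s ⟨hs, hst.trans ht⟩, ← heq t ⟨hs.trans hst, ht⟩] at this

/-- Two fixed points of the Picard map agree: their distance is at most half of itself. -/
theorem IsPicardStep.eqOn (hsY : IsPicardStep β T X XX f₀ f ξ Y Y' Y Y')
    (hsZ : IsPicardStep β T X XX f₀ f ξ Z Z' Z Z') (hY : ControlledBound β T K X Y Y')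
    (hZ : ControlledBound β T K X Z Z') (hD : RodeBound β T K X XX f₀ f) (hβ : 1 / 3 < β) :
    EqOn Z Y (Icc 0 T) ∧ EqOn Z' Y' (Icc 0 T) := by
  obtain ⟨h, ε, H⟩ := exists_isScale hβ hD.one_le
  obtain ⟨B, hB, hW⟩ := hY.exists_weightedBound_sub hZ hβ hD.one_le H
  have hall : ∀ n : ℕ, WeightedBound β T X h ε (B / 2 ^ n) (fun t => Y t - Z t)
      (fun t => Y' t - Z' t) := by
    intro n
    induction n with
    | zero => simpa using hW
    | succ n ih =>
      have := hsY.weightedBound_sub hD hβ H (by positivity) hY hZ hsZ ih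
      rwa [div_div, ← pow_succ] at this
  have heq : EqOn Z Y (Icc 0 T) := by
    intro t ht
    have hlim : Filter.Tendsto (fun n : ℕ => ε ^ 3 * (B / 2 ^ n * Real.exp (t / h))) Filter.atTop
        (nhds 0) := by
      have := tendsto_pow_atTop_nhds_zero_of_lt_one (r := (1 / 2 : ℝ)) (by norm_num) (by norm_num)
      have := ((this.const_mul B).mul_const (Real.exp (t / h))).const_mul (ε ^ 3)
      simpa [div_eq_mul_inv] using this
    have h0 := ge_of_tendsto' hlim fun n => (hall n).value t ht
    exact (sub_eq_zero.1 (norm_le_zero_iff.1 h0)).symm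
  refine ⟨heq, fun t ht => ?_⟩
  rw [hsY.deriv t ht, hsZ.deriv t ht, heq ht]

end Solution

/-! ### Existence -/

section Existence

variable {V W : Type*} [NormedAddCommGroup V] [NormedSpace ℝ V]
  [NormedAddCommGroup W] [NormedSpace ℝ W]
  {β T Λ K : ℝ} {X : ℝ → V} {XX : ℝ → ℝ → ProjTensor V} {f₀ : ℝ → W → W}
  {f : ℝ → W → V →L[ℝ] W} {ξ : W}

theorem le_add_div_mul_of_window {g C D p x : ℝ} (hp : 0 < p) (hC : 0 ≤ C) (hx : 0 ≤ x)
    (hD : 0 ≤ D) (h : x < p → g ≤ C * x) (hg : g ≤ D) : g ≤ (C + D / p) * x := by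
  have h0 : 0 ≤ D / p := by positivity
  rcases lt_or_ge x p with hxp | hxp
  · exact (h hxp).trans (by gcongr; linarith)
  · calc g ≤ D / p * p := by rwa [div_mul_cancel₀ _ hp.ne']
      _ ≤ (C + D / p) * x := by gcongr; linarith

/-- A weighted bound on windows implies a bound in the controlled norm on the whole interval. -/
theorem exists_controlledBound_of_weightedBound (hD : RodeBound β T Λ X XX f₀ f) (hβ : 1 / 3 < β)
    {h ε B : ℝ} (H : IsScale β Λ h ε) (hB : 0 ≤ B) :
    ∃ K, ∀ {Y : ℝ → W} {Y' : ℝ → V →L[ℝ] W}, WeightedBound β T X h ε B Y Y' →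
      (∀ t ∈ Icc 0 T, ‖Y' t‖ ≤ Λ) → ControlledBound β T K X Y Y' := by
  have hΛ1 := hD.one_le
  have hΛ0 : 0 ≤ Λ := by linarith
  have hε := H.ε_pos
  have hε1 := H.ε_le hβ hΛ1
  have hε2 := H.ε_sq_le hβ hΛ1
  have hε3 := H.ε_cube_le hβ hΛ1
  have hh := H.h_pos
  have hE : 0 ≤ B * Real.exp (T / h) := by positivity
  have hmono : ∀ t ≤ T, B * Real.exp (t / h) ≤ B * Real.exp (T / h) := fun t ht =>
    H.weight_mono hB ht
  generalize B * Real.exp (T / h) = E at hE hmono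
  have hp : 0 < h ^ β := Real.rpow_pos_of_pos hh β
  have hwin : ∀ s t, s ≤ t → (t - s) ^ β < h ^ β → t - s ≤ h := fun s t hst hlt =>
    ((Real.rpow_lt_rpow_iff (sub_nonneg.2 hst) hh.le (by linarith)).1 hlt).le
  obtain ⟨K, hK⟩ := (Set.toFinite {E, Λ, E + (Λ + Λ) / h ^ β,
    E + (E + E + Λ * (Λ * Λ)) / (h ^ β) ^ 2}).bddAbove
  have hK3 : E + (Λ + Λ) / h ^ β ≤ K := hK (by simp)
  have hK4 : E + (E + E + Λ * (Λ * Λ)) / (h ^ β) ^ 2 ≤ K := hK (by simp)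
  refine ⟨K, fun {Y Y'} hY hY' => ?_⟩
  have hval : ∀ t ∈ Icc 0 T, ‖Y t‖ ≤ E := fun t ht =>
    calc ‖Y t‖ ≤ 1 * E := (hY.value t ht).trans
          (mul_le_mul (by linarith) (hmono t ht.2) (by positivity) zero_le_one)
      _ = E := one_mul E
  refine ⟨fun t ht => (hval t ht).trans (hK (by simp)), fun t ht => (hY' t ht).trans
    (hK (by simp)), fun s t hs hst ht => ?_, fun s t hs hst ht => ?_⟩
  · have hx := Real.rpow_nonneg (sub_nonneg.2 hst) β
    refine (le_add_div_mul_of_window hp hE hx (by positivity) (fun hlt => ?_)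
      ((norm_sub_le _ _).trans (add_le_add (hY' t ⟨hs.trans hst, ht⟩)
        (hY' s ⟨hs, hst.trans ht⟩)))).trans (mul_le_mul_of_nonneg_right hK3 hx)
    refine (hY.deriv_holder s t hs hst ht (hwin s t hst hlt)).trans
      (mul_le_mul_of_nonneg_right ?_ hx)
    exact (mul_le_mul (by linarith : ε ≤ 1) (hmono t ht) (by positivity) zero_le_one).trans
      (one_mul E).le
  · have hx := Real.rpow_nonneg (sub_nonneg.2 hst) β
    have hX : ‖Y' s (X t - X s)‖ ≤ Λ * (Λ * Λ) := (ContinuousLinearMap.le_opNorm _ _).trans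
      (mul_le_mul (hY' s ⟨hs, hst.trans ht⟩) ((hD.rough.path s t hs hst ht).trans
        (mul_le_mul_of_nonneg_left (hD.rpow_le s t hs hst ht) hΛ0)) (norm_nonneg _) hΛ0)
    refine (le_add_div_mul_of_window (pow_pos hp 2) hE (sq_nonneg _) (by positivity)
      (fun hlt => ?_) ((norm_sub_le _ _).trans (add_le_add ((norm_sub_le _ _).trans
        (add_le_add (hval t ⟨hs.trans hst, ht⟩) (hval s ⟨hs, hst.trans ht⟩))) hX))).trans
      (mul_le_mul_of_nonneg_right hK4 (sq_nonneg _))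
    have hlt' : (t - s) ^ β < h ^ β := lt_of_pow_lt_pow_left₀ 2 hp.le hlt
    exact (hY.remainder s t hs hst ht (hwin s t hst hlt')).trans
      (mul_le_mul_of_nonneg_right (hmono t ht) (sq_nonneg _))

variable [CompleteSpace W]

/-- The Picard iterates, which are bounded uniformly in the controlled norm. -/
theorem exists_picard_sequence (hD : RodeBound β T Λ X XX f₀ f) (hβ : 1 / 3 < β) (hT : 0 ≤ T)
    (ξ : W) : ∃ (K : ℝ) (Y : ℕ → ℝ → W) (Y' : ℕ → ℝ → V →L[ℝ] W),
      (∀ n, ControlledBound β T K X (Y n) (Y' n)) ∧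
      ∀ n, IsPicardStep β T X XX f₀ f ξ (Y n) (Y' n) (Y (n + 1)) (Y' (n + 1)) := by
  have hΛ1 := hD.one_le
  obtain ⟨h, ε, H⟩ := exists_isScale hβ hΛ1
  have hε := H.ε_pos
  have hκ := sewingConst_pos (θ := 3 * β) (by linarith)
  have hG := pow_le_sewingConst_mul_pow hβ hΛ1 (k := 0) (by norm_num)
  obtain ⟨B, hB⟩ : ∃ B, 32 * (sewingConst (3 * β) * Λ ^ 6) * (1 + ‖ξ‖) = ε ^ 3 * B :=
    ⟨32 * (sewingConst (3 * β) * Λ ^ 6) * (1 + ‖ξ‖) / ε ^ 3, by field_simp⟩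
  have hξB : ‖ξ‖ ≤ ε ^ 3 * B := by rw [← hB]; nlinarith [norm_nonneg ξ]
  have hB0 : 0 ≤ B := nonneg_of_mul_nonneg_right ((norm_nonneg ξ).trans hξB) (by positivity)
  obtain ⟨K, hK⟩ := exists_controlledBound_of_weightedBound hD hβ H hB0
  let S := {p : (ℝ → W) × (ℝ → V →L[ℝ] W) //
    WeightedBound β T X h ε B p.1 p.2 ∧ ∀ t ∈ Icc 0 T, ‖p.2 t‖ ≤ Λ}
  have hstep : ∀ p : S, ∃ q : S, IsPicardStep β T X XX f₀ f ξ p.1.1 p.1.2 q.1.1 q.1.2 := by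
    rintro ⟨⟨Y, Y'⟩, hY, hY'⟩
    obtain ⟨Y₁, hY₁⟩ := (hK hY hY').exists_isPicardStep hD hβ hT ξ
    exact ⟨⟨⟨Y₁, _⟩, hY₁.weightedBound hD hβ H hB.le (hK hY hY') hY hY',
      fun t ht => hD.field.norm_le t ht _⟩, hY₁⟩
  choose F hF using hstep
  -- the iteration starts at the constant path `ξ`
  let p₀ : S := ⟨⟨fun _ => ξ, fun _ => 0⟩, ⟨fun t ht => by
      refine hξB.trans (mul_le_mul_of_nonneg_left (H.le_weight hB0 ht.1) (by positivity)),
    fun t ht => by simp only [norm_zero]; positivity,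
    fun s t hs hst ht _ => by
      have := Real.rpow_nonneg (sub_nonneg.2 hst) β
      simp only [sub_self, norm_zero]; positivity,
    fun s t hs hst ht _ => by simp only [sub_self, zero_apply, norm_zero]; positivity⟩,
    fun t ht => by simp only [norm_zero]; linarith⟩
  refine ⟨K, fun n => (F^[n] p₀).1.1, fun n => (F^[n] p₀).1.2,
    fun n => hK (F^[n] p₀).2.1 (F^[n] p₀).2.2, fun n => ?_⟩
  simp only [Function.iterate_succ_apply']
  exact hF _

theorem ControlledBound.of_tendsto {V W : Type*} [NormedAddCommGroup V] [NormedSpace ℝ V]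
    [NormedAddCommGroup W] [NormedSpace ℝ W] {X : ℝ → V} {Y : ℕ → ℝ → W} {Y' : ℕ → ℝ → V →L[ℝ] W}
    {y : ℝ → W} {y' : ℝ → V →L[ℝ] W} (h : ∀ n, ControlledBound β T K X (Y n) (Y' n))
    (hy : ∀ t ∈ Icc 0 T, Filter.Tendsto (fun n => Y n t) Filter.atTop (nhds (y t)))
    (hy' : ∀ t ∈ Icc 0 T, Filter.Tendsto (fun n => Y' n t) Filter.atTop (nhds (y' t))) :
    ControlledBound β T K X y y' where
  value t ht := le_of_tendsto' (hy t ht).norm fun n => (h n).value t ht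
  deriv t ht := le_of_tendsto' (hy' t ht).norm fun n => (h n).deriv t ht
  deriv_holder s t hs hst ht :=
    le_of_tendsto' ((hy' t ⟨hs.trans hst, ht⟩).sub (hy' s ⟨hs, hst.trans ht⟩)).norm
      fun n => (h n).deriv_holder s t hs hst ht
  remainder s t hs hst ht :=
    le_of_tendsto' (((hy t ⟨hs.trans hst, ht⟩).sub (hy s ⟨hs, hst.trans ht⟩)).sub
      (((ContinuousLinearMap.apply ℝ W (X t - X s)).continuous.tendsto _).comp
        (hy' s ⟨hs, hst.trans ht⟩))).norm
      fun n => (h n).remainder s t hs hst ht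

theorem continuous_tensorLift (x : ProjTensor V) :
    Continuous fun B : V →L[ℝ] V →L[ℝ] W => tensorLift B x := by
  have h : LipschitzWith ‖x‖₊ fun B : V →L[ℝ] V →L[ℝ] W => tensorLift B x :=
    LipschitzWith.of_dist_le_mul fun B B' => by
      rw [dist_eq_norm, dist_eq_norm B B', ← tensorLift_sub, coe_nnnorm, mul_comm]
      exact norm_tensorLift_apply_le _ _
  exact h.continuous

/-- The expansion error is continuous with respect to pointwise convergence of uniformly bounded
controlled paths. -/
theorem tendsto_picardError (hD : RodeBound β T Λ X XX f₀ f) (hβ : 0 < β)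
    {Y Y₁ : ℕ → ℝ → W} {Y' : ℕ → ℝ → V →L[ℝ] W} {y y₁ : ℝ → W} {y' : ℝ → V →L[ℝ] W}
    (h : ∀ n, ControlledBound β T K X (Y n) (Y' n))
    (hy : ∀ t ∈ Icc 0 T, Filter.Tendsto (fun n => Y n t) Filter.atTop (nhds (y t)))
    (hy' : ∀ t ∈ Icc 0 T, Filter.Tendsto (fun n => Y' n t) Filter.atTop (nhds (y' t)))
    (hy₁ : ∀ t ∈ Icc 0 T, Filter.Tendsto (fun n => Y₁ n t) Filter.atTop (nhds (y₁ t)))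
    {s t : ℝ} (hs : s ∈ Icc 0 T) (ht : t ∈ Icc 0 T) :
    Filter.Tendsto (fun n => picardError X XX f₀ f (Y n) (Y' n) (Y₁ n) s t) Filter.atTop
      (nhds (picardError X XX f₀ f y y' y₁ s t)) := by
  have hΛ0 : 0 ≤ Λ := by linarith [hD.one_le]
  have hsub : uIoc s t ⊆ Icc 0 T := uIoc_subset_uIcc.trans (uIcc_subset_Icc hs ht)
  have hint : Filter.Tendsto (fun n => ∫ r in s..t, f₀ r (Y n r)) Filter.atTop
      (nhds (∫ r in s..t, f₀ r (y r))) := by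
    refine intervalIntegral.tendsto_integral_filter_of_dominated_convergence
      (fun _ => Λ * (1 + K)) (Filter.Eventually.of_forall fun n => ?_)
      (Filter.Eventually.of_forall fun n => Filter.Eventually.of_forall fun r hr => ?_)
      intervalIntegrable_const (Filter.Eventually.of_forall fun r hr => ?_)
    · exact ((h n).intervalIntegrable hD hβ hs ht).def'.aestronglyMeasurable
    · refine (hD.drift.growth r (hsub hr) _).trans ?_
      have := (h n).value r (hsub hr)
      gcongr
    · have hlip := hy r (hsub hr)
      rw [tendsto_iff_norm_sub_tendsto_zero] at hlip ⊢
      exact squeeze_zero (fun _ => norm_nonneg _)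
        (fun n => hD.drift.lipschitz r (hsub hr) _ _) (by simpa using hlip.const_mul Λ)
  have hf : Filter.Tendsto (fun n => f s (Y n s)) Filter.atTop (nhds (f s (y s))) :=
    ((hD.field.hasFDerivAt s hs (y s)).continuousAt.tendsto).comp (hy s hs)
  have hf' : Filter.Tendsto (fun n => fderiv ℝ (f s) (Y n s)) Filter.atTop
      (nhds (fderiv ℝ (f s) (y s))) :=
    ((hD.field.hasFDerivAt_fderiv s hs (y s)).continuousAt.tendsto).comp (hy s hs)
  have hcomp : Filter.Tendsto (fun n => (fderiv ℝ (f s) (Y n s)).comp (Y' n s)) Filter.atTop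
      (nhds ((fderiv ℝ (f s) (y s)).comp (y' s))) :=
    (isBoundedBilinearMap_comp.continuous.tendsto (fderiv ℝ (f s) (y s), y' s)).comp
      (hf'.prodMk_nhds (hy' s hs))
  exact (((hy₁ t ht).sub (hy₁ s hs)).sub hint).sub
    ((((ContinuousLinearMap.apply ℝ W (X t - X s)).continuous.tendsto _).comp hf).add
      (((continuous_tensorLift _).tendsto _).comp hcomp))

/-- The Picard iterates converge, because Picard steps are contractions, and the limit is a fixed
point. -/
theorem exists_isPicardStep_self (hβ : 1 / 3 < β) (hT : 0 ≤ T)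
    {C : ℝ} (hD : ∀ Λ ≥ C, RodeBound β T Λ X XX f₀ f) (ξ : W) :
    ∃ (K : ℝ) (y : ℝ → W) (y' : ℝ → V →L[ℝ] W), ControlledBound β T K X y y' ∧
      IsPicardStep β T X XX f₀ f ξ y y' y y' := by
  obtain ⟨K₀, Y, Y', hY₀, hstep⟩ := exists_picard_sequence (hD C le_rfl) hβ hT ξ
  set K := max K₀ C
  have hY := fun n => (hY₀ n).mono (le_max_left K₀ C)
  replace hD := hD K (le_max_right K₀ C)
  have hK1 := hD.one_le
  obtain ⟨h, ε, H⟩ := exists_isScale hβ hK1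
  obtain ⟨B, hB, hW⟩ := (hY 1).exists_weightedBound_sub (hY 0) hβ hK1 H
  have hall : ∀ n : ℕ, WeightedBound β T X h ε (B / 2 ^ n) (fun t => Y (n + 1) t - Y n t)
      (fun t => Y' (n + 1) t - Y' n t) := by
    intro n
    induction n with
    | zero => simpa using hW
    | succ n ih =>
      have := (hstep (n + 1)).weightedBound_sub hD hβ H (by positivity) (hY (n + 1)) (hY n)
        (hstep n) ih
      rwa [div_div, ← pow_succ] at this
  have hcauchy : ∀ t ∈ Icc 0 T, CauchySeq fun n => Y n t := by
    intro t ht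
    refine cauchySeq_of_le_geometric (1 / 2) (ε ^ 3 * (B * Real.exp (t / h))) (by norm_num)
      fun n => ?_
    rw [dist_comm, dist_eq_norm]
    refine ((hall n).value t ht).trans (le_of_eq ?_)
    rw [one_div, inv_pow]
    ring
  choose! y hy using fun t ht => cauchySeq_tendsto_of_complete (hcauchy t ht)
  have hy1 : ∀ t ∈ Icc 0 T, Filter.Tendsto (fun n => Y (n + 1) t) Filter.atTop (nhds (y t)) :=
    fun t ht => (hy t ht).comp (Filter.tendsto_add_atTop_nat 1)
  have hy2 : ∀ t ∈ Icc 0 T, Filter.Tendsto (fun n => Y (n + 1 + 1) t) Filter.atTop (nhds (y t)) :=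
    fun t ht => (hy1 t ht).comp (Filter.tendsto_add_atTop_nat 1)
  have hy' : ∀ t ∈ Icc 0 T,
      Filter.Tendsto (fun n => Y' (n + 1) t) Filter.atTop (nhds (f t (y t))) := by
    intro t ht
    simp only [(hstep _).deriv t ht]
    exact ((hD.field.hasFDerivAt t ht (y t)).continuousAt.tendsto).comp (hy t ht)
  have h0 : (0 : ℝ) ∈ Icc 0 T := ⟨le_rfl, hT⟩
  refine ⟨K, y, fun t => f t (y t), ControlledBound.of_tendsto (fun n => hY (n + 1)) hy1 hy',
    tendsto_nhds_unique (hy1 0 h0) ?_, fun _ _ => rfl, ?_⟩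
  · simp only [(hstep _).init]
    exact tendsto_const_nhds
  · obtain ⟨C', hC', hcomp⟩ := exists_controlledBound_comp hD (by linarith : 0 ≤ K)
    refine ⟨sewingConst (3 * β) * (2 * K * C'), fun s t hs hst ht => ?_⟩
    refine le_of_tendsto' (tendsto_picardError hD (by linarith) (fun n => hY (n + 1)) hy1 hy' hy2
      ⟨hs, hst.trans ht⟩ ⟨hs.trans hst, ht⟩).norm fun n => ?_
    obtain ⟨m, hm⟩ := (hstep (n + 1)).expansion
    obtain ⟨h1, h2⟩ := hcomp (hY (n + 1))
    exact hD.rough.norm_le_of_germ hβ (by linarith)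
      (fun s u t hs hsu hut ht => (hY (n + 1)).picardError_defect hD (by linarith) _ hs hsu hut ht)
      hm hs hst ht hC' (fun a b ha hab hb => h1 a b (hs.trans ha) hab (hb.trans ht))
      (fun a b ha hab hb => h2 a b (hs.trans ha) hab (hb.trans ht))

end Existence

theorem mainTheorem12 {V W : Type*}
    [NormedAddCommGroup V] [NormedSpace ℝ V] [CompleteSpace V]
    [NormedAddCommGroup W] [NormedSpace ℝ W] [CompleteSpace W]
    (T : ℝ) (hT : 0 ≤ T) (β : ℝ) (hβ : β ∈ Set.Ioc (1 / 3 : ℝ) (1 / 2))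
    (X : ℝ → V) (XX : ℝ → ℝ → ProjTensor V) (hX : IsRoughPath β T X XX)
    (f₀ : ℝ → W → W) (hf₀ : IsLip T f₀)
    (f : ℝ → W → V →L[ℝ] W) (hf : IsCb (2 * β) 3 T f) (ξ : W) :
    ∃ (Y : ℝ → W) (Y' : ℝ → V →L[ℝ] W),
      IsRODESolution β T X XX f₀ f ξ Y Y' ∧
      ∀ (Z : ℝ → W) (Z' : ℝ → V →L[ℝ] W), IsRODESolution β T X XX f₀ f ξ Z Z' →
        Set.EqOn Z Y (Set.Icc 0 T) ∧ Set.EqOn Z' Y' (Set.Icc 0 T) := by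
  obtain ⟨C, hD⟩ := exists_rodeBound hβ hT hX hf₀ hf
  obtain ⟨K₁, Y, Y', hY, hstep⟩ := exists_isPicardStep_self hβ.1 hT hD ξ
  refine ⟨Y, Y', hstep.isRODESolution hY (hD C le_rfl) hβ.1 hT, fun Z Z' hsol => ?_⟩
  obtain ⟨K₂, hZ⟩ := hsol.controlled.exists_controlledBound (by linarith [hβ.1])
  obtain ⟨K, hK⟩ := (Set.toFinite {K₁, K₂, C}).bddAbove
  have hK₁ : K₁ ≤ K := hK (by simp)
  have hK₂ : K₂ ≤ K := hK (by simp)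
  have hK₃ : C ≤ K := hK (by simp)
  exact hstep.eqOn (hsol.isPicardStep hZ (hD C le_rfl) hβ.1 hT) (hY.mono hK₁) (hZ.mono hK₂)
    (hD K hK₃) hβ.1
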